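/- Let $(M,g,J)$ be a Hermitian manifold of real dimension $2n$: a smooth manifold with a Riemannian metric $g$ and a complex structure $J$ (a smooth almost complex structure with vanishing Nijenhuis tensor) such that $g(JX,JY)=g(X,Y)$. Put $\Omega(X,Y)=g(X,JY)$ and $d^c\Omega(X,Y,Z)=-d\Omega(JX,JY,JZ)$, and let $\nabla$ be the Bismut connection, $g(\nabla_XY,Z)=g(\nabla^g_XY,Z)+\frac12 d^c\Omega(X,Y,Z)$, where $\nabla^g$ is the Levi-Civita connection; $(M,g,J,\nabla)$ is called a KT manifold. Let $T(X,Y)=\nabla_XY-\nabla_YX-[X,Y]$ be its torsion, regarded also as the $3$-form $T(X,Y,Z)=g(T(X,Y),Z)$. Let $d^\dagger$ be the formal adjoint of $d$, $d^\dagger\alpha=-\sum_i(\nabla^g_{e_i}\alpha)(e_i,\cdot,\dots,\cdot)$, and let $\theta=d^\dagger\Omega\circ J$ be the Lee form; here and below $e_1,\dots,e_{2n}$ is any orthonormal basis of the tangent space. Let $R(X,Y)Z=\nabla_X\nabla_YZ-\nabla_Y\nabla_XZ-\nabla_{[X,Y]}Z$ and $R(X,Y,Z,V)=g(R(X,Y)Z,V)$,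 and put $$Ric(X,Y)=\sum_i R(e_i,X,Y,e_i),\qquad \rho(X,Y)=\tfrac12\sum_i R(X,Y,e_i,Je_i),\qquad \lambda^\Omega(X,Y)=\sum_i dT(X,Y,e_i,Je_i),$$ $$b=\sum_j\rho(Je_j,e_j),\qquad Scal^\nabla=\sum_j Ric(e_j,e_j).$$ Let $Ric^g$ be the Ricci tensor of $\nabla^g$, defined in the same way from the curvature of $\nabla^g$. Norms are tensor norms, $|\theta|^2=\sum_i\theta(e_i)^2$ and $|T|^2=\sum_{i,j,k}T(e_i,e_j,e_k)^2$. Then, at every point of $M$ and for all tangent vectors $X,Y$ there, $$Ric^g(X,Y)=Ric(X,Y)+\tfrac12\,d^\dagger T(X,Y)+\tfrac14\sum_i g\big(T(X,e_i),T(Y,e_i)\big),$$ $$\rho(X,Y)=Ric(X,JY)+(\nabla_X\theta)(JY)+\tfrac14\lambda^\Omega(X,Y),$$ $$b=Scal^\nabla-3\,d^\dagger\theta-2|\theta|^2+\tfrac13|T|^2.$$ -/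

import Mathlib

open scoped Manifold ContDiff Topology
open Bundle

noncomputable section

namespace KT

/-! ### Contractions with an inner product on a finite-dimensional space -/

section Algebra

variable {E : Type*} [NormedAddCommGroup E] [NormedSpace ℝ E] [FiniteDimensional ℝ E]

/-- The vector dual to a covector `f`: the inverse of the map `v ↦ G(v, ·)`, applied to `f`. -/
def sharp (G : E →L[ℝ] E →L[ℝ] ℝ) (f : E →L[ℝ] ℝ) : E :=
  ContinuousLinearMap.inverse G f

/-- The `i`-th coordinate covector of the fixed reference basis `Module.finBasis ℝ E`. -/
def coordForm (i : Fin (Module.finrank ℝ E)) : E →L[ℝ] ℝ :=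
  LinearMap.toContinuousLinearMap ((Module.finBasis ℝ E).coord i)

/-- Index raising `v^k = G^{ki} f_i` of a linear function `f`: the vector `v` with
`G(v, w) = f w` for all `w` (see `inner_raise`). -/
def raise (G : E →L[ℝ] E →L[ℝ] ℝ) (f : E → ℝ) : E :=
  ∑ i, f (Module.finBasis ℝ E i) • sharp G (coordForm i)

/-- The trace `G^{ij} B_{ij}` of a bilinear function `B` with respect to the inner product `G`.
For every `G`-orthonormal basis `e` it equals `∑ i, B (e i) (e i)` (see `metricTrace_eq_sum`). -/
def metricTrace (G : E →L[ℝ] E →L[ℝ] ℝ) (B : E → E → ℝ) : ℝ :=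
  ∑ i, B (Module.finBasis ℝ E i) (sharp G (coordForm i))

theorem inner_sharp (G : E →L[ℝ] E →L[ℝ] ℝ) (pos : ∀ v, v ≠ 0 → 0 < G v v)
    (f : E →L[ℝ] ℝ) : G (sharp G f) = f := by
  have hinj : Function.Injective (G : E →ₗ[ℝ] (E →L[ℝ] ℝ)) := by
    rw [injective_iff_map_eq_zero]
    intro v hv
    by_contra h
    have h1 := pos v h
    have h2 : G v = 0 := hv
    simp [h2] at h1
  have hdim : Module.finrank ℝ E = Module.finrank ℝ (E →L[ℝ] ℝ) := by
    rw [← LinearEquiv.finrank_eq (LinearMap.toContinuousLinearMap (𝕜 := ℝ) (E := E) (F' := ℝ))]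
    exact (Subspace.dual_finrank_eq (K := ℝ) (V := E)).symm
  let e := (LinearEquiv.ofInjectiveOfFinrankEq (G : E →ₗ[ℝ] (E →L[ℝ] ℝ)) hinj
    hdim).toContinuousLinearEquiv
  have he : (e : E →L[ℝ] (E →L[ℝ] ℝ)) = G := by
    ext v w
    rfl
  unfold sharp
  rw [← he, ContinuousLinearMap.inverse_equiv]
  simp

theorem inner_raise (G : E →L[ℝ] E →L[ℝ] ℝ) (pos : ∀ v, v ≠ 0 → 0 < G v v)
    (f : E →ₗ[ℝ] ℝ) (w : E) : G (raise G f) w = f w := by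
  have h : f w = f (∑ i, (Module.finBasis ℝ E).repr w i • Module.finBasis ℝ E i) := by
    rw [(Module.finBasis ℝ E).sum_repr w]
  rw [h, map_sum]
  simp [raise, inner_sharp G pos, coordForm, mul_comm]

theorem metricTrace_eq_sum (G : E →L[ℝ] E →L[ℝ] ℝ) (pos : ∀ v, v ≠ 0 → 0 < G v v)
    (B : E →ₗ[ℝ] E →ₗ[ℝ] ℝ) {ι : Type*} [Fintype ι] [DecidableEq ι] (e : Module.Basis ι ℝ E)
    (he : ∀ i j, G (e i) (e j) = if i = j then 1 else 0) :
    metricTrace G (fun u v => B u v) = ∑ i, B (e i) (e i) := by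
  have h1 : ∀ (v : E) (k : ι), e.repr v k = G v (e k) := by
    intro v k
    have h : G v (e k) = G (∑ i, e.repr v i • e i) (e k) := by rw [e.sum_repr v]
    rw [h, map_sum]
    simp only [map_smul, sum_apply, smul_apply, he]
    simp
  have h2 : ∀ f : E →L[ℝ] ℝ, sharp G f = ∑ k, f (e k) • e k := by
    intro f
    conv_lhs => rw [← e.sum_repr (sharp G f)]
    simp [h1, inner_sharp G pos]
  have h3 : ∀ k, e k = ∑ i, (coordForm i (e k)) • Module.finBasis ℝ E i := by
    intro k
    conv_lhs => rw [← (Module.finBasis ℝ E).sum_repr (e k)]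
    simp [coordForm]
  unfold metricTrace
  simp only [h2, map_sum, map_smul]
  rw [Finset.sum_comm]
  refine Finset.sum_congr rfl fun k _ => ?_
  have h4 : B (e k) (e k) = B (∑ i, (coordForm i (e k)) • Module.finBasis ℝ E i) (e k) := by
    rw [← h3 k]
  rw [h4]
  simp

end Algebra

/-! ### Tensor calculus on a finite-dimensional space (that is, in one coordinate chart)

`g` is a field of inner products, `J` a field of endomorphisms. A `k`-tensor or `k`-form is a
function `α : E → (Fin k → E) → ℝ`, `α y v = α_y(v₀, …, v_{k-1})`. A connection is given by its
coefficients `A : E → E → E → E`, `A y u v = ∇_u v` at `y` for the constant fields `u`, `v`. -/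

section Local

variable {E : Type*} [NormedAddCommGroup E] [NormedSpace ℝ E]

/-- The vector field `∇_X Y`. -/
def covAlong (A : E → E → E → E) (X Y : E → E) : E → E :=
  fun y => fderiv ℝ Y y (X y) + A y (X y) (Y y)

/-- The torsion `T(X,Y) = ∇_X Y - ∇_Y X - [X,Y]`. -/
def torsionField (A : E → E → E → E) (X Y : E → E) : E → E :=
  fun y => covAlong A X Y y - covAlong A Y X y - VectorField.lieBracket ℝ X Y y

/-- The curvature `R(X,Y)Z = ∇_X ∇_Y Z - ∇_Y ∇_X Z - ∇_{[X,Y]} Z`. -/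
def curvatureField (A : E → E → E → E) (X Y Z : E → E) : E → E :=
  fun y => covAlong A X (covAlong A Y Z) y - covAlong A Y (covAlong A X Z) y
    - covAlong A (VectorField.lieBracket ℝ X Y) Z y

/-- The torsion tensor at `y`, evaluated on vectors through constant fields. -/
def torsion (A : E → E → E → E) (y u v : E) : E :=
  torsionField A (fun _ => u) (fun _ => v) y

/-- The curvature tensor at `y`, evaluated on vectors through constant fields. -/
def curvature (A : E → E → E → E) (y u v w : E) : E :=
  curvatureField A (fun _ => u) (fun _ => v) (fun _ => w) y

/-- The covariant derivative `(∇_u α)(v₀, …, v_{k-1})` of a `k`-tensor. -/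
def covTensor (A : E → E → E → E) {k : ℕ} (α : E → (Fin k → E) → ℝ) (y u : E)
    (v : Fin k → E) : ℝ :=
  fderiv ℝ (fun z => α z v) y u - ∑ i, α y (Function.update v i (A y u (v i)))

/-- The exterior derivative of a `k`-form, with the normalization of `extDeriv`
(see `extD_eq_extDeriv`). -/
def extD {k : ℕ} (α : E → (Fin k → E) → ℝ) (y : E) (v : Fin (k + 1) → E) : ℝ :=
  ∑ i : Fin (k + 1), (-1) ^ (i : ℕ) * fderiv ℝ (fun z => α z (i.removeNth v)) y (v i)

theorem extD_eq_extDeriv {k : ℕ} (α : E → E [⋀^Fin k]→L[ℝ] ℝ) (y : E)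
    (h : DifferentiableAt ℝ α y) (v : Fin (k + 1) → E) :
    extD (fun z w => α z w) y v = extDeriv α y v := by
  rw [extDeriv_apply h]
  simp [extD]

/-- The Nijenhuis tensor `[JX,JY] - J[JX,Y] - J[X,JY] - [X,Y]` of `J`. -/
def nijenhuis (J : E → E →L[ℝ] E) (y u v : E) : E :=
  VectorField.lieBracket ℝ (fun z => J z u) (fun z => J z v) y
    - J y (VectorField.lieBracket ℝ (fun z => J z u) (fun _ => v) y)
    - J y (VectorField.lieBracket ℝ (fun _ => u) (fun z => J z v) y)
    - VectorField.lieBracket ℝ (fun _ => u) (fun _ => v) y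

/-- The Kähler form `Ω(u,v) = g(u, Jv)`. -/
def kahlerForm (g : E → E →L[ℝ] E →L[ℝ] ℝ) (J : E → E →L[ℝ] E) (y : E) (v : Fin 2 → E) : ℝ :=
  g y (v 0) (J y (v 1))

/-- The form `d^c Ω(u,v,w) = -dΩ(Ju,Jv,Jw)`. -/
def dcKahler (g : E → E →L[ℝ] E →L[ℝ] ℝ) (J : E → E →L[ℝ] E) (y : E) (v : Fin 3 → E) : ℝ :=
  - extD (kahlerForm g J) y (fun i => J y (v i))

variable [FiniteDimensional ℝ E]

/-- The Levi-Civita connection, through its Christoffel symbols: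
`2 g(Γ(u,v), w) = ∂_u g(v,w) + ∂_v g(u,w) - ∂_w g(u,v)`. -/
def leviCivita (g : E → E →L[ℝ] E →L[ℝ] ℝ) (y u v : E) : E :=
  raise (g y) (fun w =>
    (1 / 2 : ℝ) * (fderiv ℝ g y u v w + fderiv ℝ g y v u w - fderiv ℝ g y w u v))

/-- The Bismut connection `g(∇_u v, w) = g(∇^g_u v, w) + ½ d^c Ω(u,v,w)`. -/
def bismut (g : E → E →L[ℝ] E →L[ℝ] ℝ) (J : E → E →L[ℝ] E) (y u v : E) : E :=
  leviCivita g y u v + (1 / 2 : ℝ) • raise (g y) (fun w => dcKahler g J y ![u, v, w])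

/-- The formal adjoint `d†` of `d` on `(k+1)`-forms:
`d†α(v₁, …, v_k) = -∑ i, (∇^g_{e_i} α)(e_i, v₁, …, v_k)`. -/
def codiff (g : E → E →L[ℝ] E →L[ℝ] ℝ) {k : ℕ} (α : E → (Fin (k + 1) → E) → ℝ) (y : E)
    (v : Fin k → E) : ℝ :=
  - metricTrace (g y) (fun a b => covTensor (leviCivita g) α y a (Fin.cons b v))

/-- The Lee form `θ = d†Ω ∘ J`. -/
def leeForm (g : E → E →L[ℝ] E →L[ℝ] ℝ) (J : E → E →L[ℝ] E) (y : E) (v : Fin 1 → E) : ℝ :=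
  codiff g (kahlerForm g J) y ![J y (v 0)]

/-- The torsion of the Bismut connection as a 3-form, `T(u,v,w) = g(T(u,v), w)`. -/
def torsionForm (g : E → E →L[ℝ] E →L[ℝ] ℝ) (J : E → E →L[ℝ] E) (y : E)
    (v : Fin 3 → E) : ℝ :=
  g y (torsion (bismut g J) y (v 0) (v 1)) (v 2)

/-- The Ricci tensor `Ric(u,v) = ∑ i, g(R(e_i,u)v, e_i)` of a connection. -/
def ricci (g : E → E →L[ℝ] E →L[ℝ] ℝ) (A : E → E → E → E) (y u v : E) : ℝ :=
  metricTrace (g y) (fun a b => g y (curvature A y a u v) b)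

/-- The Ricci form `ρ(u,v) = ½ ∑ i, g(R(u,v)e_i, Je_i)` of a connection. -/
def ricciForm (g : E → E →L[ℝ] E →L[ℝ] ℝ) (J : E → E →L[ℝ] E) (A : E → E → E → E)
    (y u v : E) : ℝ :=
  (1 / 2 : ℝ) * metricTrace (g y) (fun a b => g y (curvature A y u v a) (J y b))

/-- The trace `λ^Ω(u,v) = ∑ i, dT(u,v,e_i,Je_i)`. -/
def lambdaOmega (g : E → E →L[ℝ] E →L[ℝ] ℝ) (J : E → E →L[ℝ] E) (y u v : E) : ℝ :=
  metricTrace (g y) (fun a b => extD (torsionForm g J) y ![u, v, a, J y b])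

/-- The squared norm `|α|² = ∑ i, α(e_i)²` of a 1-form. -/
def normSq₁ (G : E →L[ℝ] E →L[ℝ] ℝ) (α : (Fin 1 → E) → ℝ) : ℝ :=
  metricTrace G (fun a b => α ![a] * α ![b])

/-- The squared tensor norm `|α|² = ∑ i j k, α(e_i,e_j,e_k)²` of a 3-tensor. -/
def normSq₃ (G : E →L[ℝ] E →L[ℝ] ℝ) (α : (Fin 3 → E) → ℝ) : ℝ :=
  metricTrace G (fun a a' => metricTrace G (fun b b' => metricTrace G (fun c c' =>
    α ![a, b, c] * α ![a', b', c'])))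

end Local

/-! ### Hermitian manifolds and their Bismut geometry -/

section Manifold

variable (E : Type*) [NormedAddCommGroup E] [NormedSpace ℝ E]
  (M : Type*) [TopologicalSpace M] [ChartedSpace E M] [IsManifold 𝓘(ℝ, E) ∞ M]

/-- An endomorphism field `J` of `TM` in the preferred chart `φ` at `x`:
at `y` it is `dφ ∘ J ∘ d(φ⁻¹)`. -/
def coordEnd {E : Type*} [NormedAddCommGroup E] [NormedSpace ℝ E]
    {M : Type*} [TopologicalSpace M] [ChartedSpace E M]
    (J : ∀ p : M, TangentSpace 𝓘(ℝ, E) p →L[ℝ] TangentSpace 𝓘(ℝ, E) p) (x : M) (y : E) :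
    E →L[ℝ] E :=
  (mfderiv 𝓘(ℝ, E) 𝓘(ℝ, E) (extChartAt 𝓘(ℝ, E) x) ((extChartAt 𝓘(ℝ, E) x).symm y)) ∘L
    (J ((extChartAt 𝓘(ℝ, E) x).symm y)) ∘L
    (mfderiv 𝓘(ℝ, E) 𝓘(ℝ, E) (extChartAt 𝓘(ℝ, E) x).symm y)

/-- A field of bilinear forms on `TM` in the preferred chart `φ` at `x`: its pullback under `φ⁻¹`. -/
def coordBilin {E : Type*} [NormedAddCommGroup E] [NormedSpace ℝ E]
    {M : Type*} [TopologicalSpace M] [ChartedSpace E M]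
    (b : ∀ p : M, TangentSpace 𝓘(ℝ, E) p →L[ℝ] TangentSpace 𝓘(ℝ, E) p →L[ℝ] ℝ)
    (x : M) (y : E) : E →L[ℝ] E →L[ℝ] ℝ :=
  let B : E →L[ℝ] E →L[ℝ] ℝ := b ((extChartAt 𝓘(ℝ, E) x).symm y)
  let D : E →L[ℝ] E := mfderiv 𝓘(ℝ, E) 𝓘(ℝ, E) (extChartAt 𝓘(ℝ, E) x).symm y
  B.bilinearComp D D

/-- A smooth Hermitian structure `(g, J)` on the smooth manifold `M`: a smooth Riemannian metric
`g` and a complex structure `J` (a smooth almost complex structure whose Nijenhuis tensor vanishes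
in the preferred chart at every point) with `g(JX, JY) = g(X, Y)`. A KT manifold is such a manifold together
with its Bismut connection, which is determined by `(g, J)`. -/
structure HermitianStructure where
  /-- the Riemannian metric -/
  g : ContMDiffRiemannianMetric 𝓘(ℝ, E) ∞ E (fun p : M => TangentSpace 𝓘(ℝ, E) p)
  /-- the complex structure -/
  J : ∀ p : M, TangentSpace 𝓘(ℝ, E) p →L[ℝ] TangentSpace 𝓘(ℝ, E) p
  contMDiff_J : ContMDiff 𝓘(ℝ, E) (𝓘(ℝ, E).prod 𝓘(ℝ, E →L[ℝ] E)) ∞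
    (fun p : M => TotalSpace.mk' (E →L[ℝ] E)
      (E := fun p : M => TangentSpace 𝓘(ℝ, E) p →L[ℝ] TangentSpace 𝓘(ℝ, E) p) p (J p))
  J_sq : ∀ (p : M) (v : TangentSpace 𝓘(ℝ, E) p), J p (J p v) = -v
  compatible : ∀ (p : M) (v w : TangentSpace 𝓘(ℝ, E) p),
    g.inner p (J p v) (J p w) = g.inner p v w
  integrable : ∀ (x : M), ∀ y ∈ (extChartAt 𝓘(ℝ, E) x).target, ∀ u v : E,
    nijenhuis (coordEnd J x) y u v = 0

namespace HermitianStructure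

variable {E M}
variable (S : HermitianStructure E M)

/-- The metric in the preferred chart at `x`. -/
def gLoc (x : M) : E → E →L[ℝ] E →L[ℝ] ℝ := coordBilin S.g.inner x

/-- The complex structure in the preferred chart at `x`. -/
def JLoc (x : M) : E → E →L[ℝ] E := coordEnd S.J x

/-- The coordinates of the point `x` in the preferred chart at `x`. In this chart the coordinate
vector of a tangent vector `v : TangentSpace 𝓘(ℝ, E) x` is `v` itself, and the metric and the
complex structure at this point are `g` and `J` at `x` (see `gLoc_pt`, `JLoc_pt`). -/
def pt (x : M) : E := extChartAt 𝓘(ℝ, E) x x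

theorem mfderiv_chart_symm (x : M) :
    mfderiv 𝓘(ℝ, E) 𝓘(ℝ, E) (extChartAt 𝓘(ℝ, E) x).symm (extChartAt 𝓘(ℝ, E) x x)
      = ContinuousLinearMap.id ℝ E := by
  have : IsManifold 𝓘(ℝ, E) 1 M := IsManifold.of_le (n := ∞) (by norm_cast)
  have h2 := mfderivWithin_range_extChartAt_symm (I := 𝓘(ℝ, E)) (x := x)
  simp only [modelWithCornersSelf_coe, Set.range_id, mfderivWithin_univ] at h2
  exact h2

theorem gLoc_pt (x : M) (u v : TangentSpace 𝓘(ℝ, E) x) :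
    S.gLoc x (pt x) u v = S.g.inner x u v := by
  have h1 : (extChartAt 𝓘(ℝ, E) x).symm (extChartAt 𝓘(ℝ, E) x x) = x := by simp
  have h2 := mfderiv_chart_symm (E := E) x
  have h3 : ∀ p : M, p = x → ∀ D : E →L[ℝ] E, D = ContinuousLinearMap.id ℝ E →
      ((show E →L[ℝ] E →L[ℝ] ℝ from S.g.inner p).bilinearComp D D) u v
        = S.g.inner x u v := by
    rintro p rfl D rfl
    rfl
  exact h3 _ h1 _ h2

theorem JLoc_pt (x : M) (u : TangentSpace 𝓘(ℝ, E) x) :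
    S.JLoc x (pt x) u = S.J x u := by
  have h1 : (extChartAt 𝓘(ℝ, E) x).symm (extChartAt 𝓘(ℝ, E) x x) = x := by simp
  have h2 := mfderiv_chart_symm (E := E) x
  have : IsManifold 𝓘(ℝ, E) 1 M := IsManifold.of_le (n := ∞) (by norm_cast)
  have h4 := mfderiv_extChartAt_self (I := 𝓘(ℝ, E)) (x := x)
  have h3 : ∀ p : M, p = x → ∀ D : E →L[ℝ] E, D = ContinuousLinearMap.id ℝ E →
      (show E →L[ℝ] E from mfderiv 𝓘(ℝ, E) 𝓘(ℝ, E) (extChartAt 𝓘(ℝ, E) x) p)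
        ((show E →L[ℝ] E from S.J p) (D u)) = S.J x u := by
    rintro p rfl D rfl
    exact congrArg (fun L : E →L[ℝ] E => L (S.J p u)) h4
  exact h3 _ h1 _ h2

variable [FiniteDimensional ℝ E]

/-- The Ricci tensor of the Levi-Civita connection. -/
def ricciLC (x : M) (X Y : TangentSpace 𝓘(ℝ, E) x) : ℝ :=
  ricci (E := E) (S.gLoc x) (leviCivita (E := E) (S.gLoc x)) (pt x) X Y

/-- The Ricci tensor of the Bismut connection. -/
def ricciBismut (x : M) (X Y : TangentSpace 𝓘(ℝ, E) x) : ℝ :=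
  ricci (E := E) (S.gLoc x) (bismut (E := E) (S.gLoc x) (S.JLoc x)) (pt x) X Y

/-- The Ricci form `ρ` of the Bismut connection. -/
def rho (x : M) (X Y : TangentSpace 𝓘(ℝ, E) x) : ℝ :=
  ricciForm (E := E) (S.gLoc x) (S.JLoc x) (bismut (E := E) (S.gLoc x) (S.JLoc x)) (pt x) X Y

/-- The torsion `T(X,Y)` of the Bismut connection. -/
def T (x : M) (X Y : TangentSpace 𝓘(ℝ, E) x) : TangentSpace 𝓘(ℝ, E) x :=
  torsion (E := E) (bismut (E := E) (S.gLoc x) (S.JLoc x)) (pt x) X Y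

/-- The 2-form `d†T`. -/
def codiffT (x : M) (X Y : TangentSpace 𝓘(ℝ, E) x) : ℝ :=
  codiff (E := E) (S.gLoc x) (torsionForm (E := E) (S.gLoc x) (S.JLoc x)) (pt x) ![X, Y]

/-- The covariant derivative `(∇_X θ)Y` of the Lee form with respect to the Bismut connection. -/
def covTheta (x : M) (X Y : TangentSpace 𝓘(ℝ, E) x) : ℝ :=
  covTensor (E := E) (bismut (E := E) (S.gLoc x) (S.JLoc x)) (leeForm (E := E) (S.gLoc x) (S.JLoc x)) (pt x) X ![Y]

/-- The 2-form `λ^Ω`. -/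
def lam (x : M) (X Y : TangentSpace 𝓘(ℝ, E) x) : ℝ :=
  lambdaOmega (E := E) (S.gLoc x) (S.JLoc x) (pt x) X Y

/-- The function `d†θ`. -/
def codiffTheta (x : M) : ℝ :=
  codiff (E := E) (S.gLoc x) (leeForm (E := E) (S.gLoc x) (S.JLoc x)) (pt x) ![]

/-- The function `|θ|²`. -/
def normSqTheta (x : M) : ℝ :=
  normSq₁ (E := E) (S.gLoc x (pt x)) (leeForm (E := E) (S.gLoc x) (S.JLoc x) (pt x))

/-- The function `|T|²`. -/
def normSqT (x : M) : ℝ :=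
  normSq₃ (E := E) (S.gLoc x (pt x)) (torsionForm (E := E) (S.gLoc x) (S.JLoc x) (pt x))

end HermitianStructure

end Manifold

end KT

end

noncomputable section

set_option maxSynthPendingDepth 3

/-! All terms are tensors at one point, so the computation takes place in the preferred chart at
`x`, where the manifold is an open set of `E` with smooth fields `G` and `J`. Write `P = ∇^g J`.
Integrability makes `P` complex linear in the direction of differentiation (`map_J`). Consequently
`T = d^c Ω` satisfies two algebraic identities. The first, `sum_apply_J`, makes `½T` cancel `P`, so
the Bismut connection `∇ = ∇^g + ½T` satisfies `∇J = 0` (`bismut_J`); `∇g = 0` follows from the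
total skewness of `T`. The second, `type_condition`, says that `T` has type (1,2)+(2,1).

Contracting the difference of the curvatures of `∇` and `∇^g` (`curvMap_bismut_eq`) gives the
formula for `Ric^g`.

For `ρ`, the key is `curvMap_bismut_cyclic`: the cyclic sum of `R(u,v,w,x)` over `v,w,x` is `½
dT(u,v,w,x) + (∇_u T)(v,w,x)`. At `(X, Y, e_i, Je_i)`, summed over `i`, one curvature term gives
`2ρ(X,Y)`, and each of the other two gives `-Ric(X,JY)` because `R` commutes with `J`. The trace of
`∇T` is a derivative of `θ`, since `θ` is a trace of `T` and `∇` preserves `g` and `J`.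

Tracing this formula over `(Je_j, e_j)` gives `b`. The trace of `λ^Ω` is computed by writing `dT`
through `∇T` and products `g(T,T)` (`extD_torsionForm_bismut`); its quadratic part reduces to `|θ|²`
and, by the type of `T`, to `|T|²/3` (`sum_torsion_J`). -/

namespace KT

/-! ### Nondegeneracy and orthonormal expansions -/

section Inner

variable {E : Type*} [NormedAddCommGroup E] [NormedSpace ℝ E]

theorem eq_of_inner_eq {G : E →L[ℝ] E →L[ℝ] ℝ} (pos : ∀ v, v ≠ 0 → 0 < G v v) {a b : E}
    (h : ∀ w, G a w = G b w) : a = b := by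
  by_contra hab
  have h1 := pos (a - b) (sub_ne_zero.2 hab)
  have h2 := h (a - b)
  simp [h2] at h1

theorem repr_eq_inner {G : E →L[ℝ] E →L[ℝ] ℝ} {ι : Type*} [Fintype ι] [DecidableEq ι]
    (e : Module.Basis ι ℝ E) (he : ∀ i j, G (e i) (e j) = if i = j then 1 else 0) (v : E) :
    ∑ i, G v (e i) • e i = v := by
  conv_rhs => rw [← e.sum_repr v]
  refine Finset.sum_congr rfl fun k _ => ?_
  congr 1
  conv_lhs => rw [← e.sum_repr v]
  rw [map_sum]
  simp [he]

theorem inner_eq_sum {G : E →L[ℝ] E →L[ℝ] ℝ} {ι : Type*} [Fintype ι] [DecidableEq ι]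
    (e : Module.Basis ι ℝ E) (he : ∀ i j, G (e i) (e j) = if i = j then 1 else 0) (v w : E) :
    G v w = ∑ i, G v (e i) * G w (e i) := by
  conv_lhs => rw [← repr_eq_inner e he w]
  rw [map_sum]
  exact Finset.sum_congr rfl fun i _ => by rw [map_smul, smul_eq_mul, mul_comm]

end Inner

/-! ### Traces with respect to an inner product and their derivatives -/

section Algebra

variable {E : Type*} [NormedAddCommGroup E] [NormedSpace ℝ E] [FiniteDimensional ℝ E]

/-- `raise` accepts a bare function, whereas `sharp` applies the operator inverse of `G`, which
depends smoothly on `G`; this permits passing to the differentiable form. -/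
theorem raise_eq_sharp {G : E →L[ℝ] E →L[ℝ] ℝ} (pos : ∀ v, v ≠ 0 → 0 < G v v)
    (f : E →L[ℝ] ℝ) : raise G f = sharp G f := by
  refine eq_of_inner_eq pos fun w => ?_
  rw [inner_sharp G pos]
  exact inner_raise G pos f w

theorem inner_sharp_comm {G : E →L[ℝ] E →L[ℝ] ℝ} (pos : ∀ v, v ≠ 0 → 0 < G v v)
    (symm : ∀ v w, G v w = G w v) (f : E →L[ℝ] ℝ) (v : E) : G v (sharp G f) = f v := by
  rw [symm, inner_sharp G pos]

theorem sum_coordForm_smul (v : E) :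
    ∑ i, coordForm i v • Module.finBasis ℝ E i = v :=
  (Module.finBasis ℝ E).sum_repr v

theorem metricTrace_eq_double_sum (G : E →L[ℝ] E →L[ℝ] ℝ) (B : E →L[ℝ] E →L[ℝ] ℝ) :
    metricTrace G (fun u v => B u v) = ∑ i, ∑ j, coordForm j (sharp G (coordForm i)) *
      B (Module.finBasis ℝ E i) (Module.finBasis ℝ E j) := by
  unfold metricTrace
  refine Finset.sum_congr rfl fun i _ => ?_
  conv_lhs => rw [← sum_coordForm_smul (sharp G (coordForm i))]
  simp [map_sum]

theorem metricTrace_flip {G : E →L[ℝ] E →L[ℝ] ℝ} (pos : ∀ v, v ≠ 0 → 0 < G v v)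
    (symm : ∀ v w, G v w = G w v) (B : E →L[ℝ] E →L[ℝ] ℝ) :
    metricTrace G (fun u v => B v u) = metricTrace G (fun u v => B u v) := by
  have h := metricTrace_eq_double_sum G B.flip
  simp only [ContinuousLinearMap.flip_apply] at h
  rw [h, metricTrace_eq_double_sum G B, Finset.sum_comm]
  refine Finset.sum_congr rfl fun i _ => Finset.sum_congr rfl fun j _ => ?_
  congr 1
  -- What remains is the symmetry `G^{ij} = G^{ji}` of the inverse matrix.
  rw [← inner_sharp_comm pos symm (coordForm i), inner_sharp G pos]

theorem metricTrace_add (G : E →L[ℝ] E →L[ℝ] ℝ) (B C : E → E → ℝ) :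
    metricTrace G (fun u v => B u v + C u v) = metricTrace G B + metricTrace G C :=
  Finset.sum_add_distrib

theorem metricTrace_const_mul (G : E →L[ℝ] E →L[ℝ] ℝ) (r : ℝ) (B : E → E → ℝ) :
    metricTrace G (fun u v => r * B u v) = r * metricTrace G B :=
  (Finset.mul_sum _ _ _).symm

theorem metricTrace_eq_zero_of_skew {G : E →L[ℝ] E →L[ℝ] ℝ} (pos : ∀ v, v ≠ 0 → 0 < G v v)
    (symm : ∀ v w, G v w = G w v) (B : E →L[ℝ] E →L[ℝ] ℝ) (skew : ∀ u v, B u v = - B v u) :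
    metricTrace G (fun u v => B u v) = 0 := by
  have h := metricTrace_flip pos symm B
  have h2 : metricTrace G (fun u v => B u v) = - metricTrace G (fun u v => B v u) := by
    rw [← neg_one_mul, ← metricTrace_const_mul]
    congr 1
    funext u v
    rw [skew]; ring
  linarith

theorem metricTrace_eq_sum_clm {G : E →L[ℝ] E →L[ℝ] ℝ} (pos : ∀ v, v ≠ 0 → 0 < G v v)
    {ι : Type*} [Fintype ι] [DecidableEq ι] (e : Module.Basis ι ℝ E)
    (he : ∀ i j, G (e i) (e j) = if i = j then 1 else 0) (B : E →L[ℝ] E →L[ℝ] ℝ) :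
    metricTrace G (fun u v => B u v) = ∑ i, B (e i) (e i) :=
  metricTrace_eq_sum G pos
    ((ContinuousLinearMap.coeLM ℝ).comp (B : E →ₗ[ℝ] E →L[ℝ] ℝ)) e he

/-- The trace of a bilinear form is unchanged under an isometry of the metric. -/
theorem sum_isometry {G : E →L[ℝ] E →L[ℝ] ℝ} (pos : ∀ v, v ≠ 0 → 0 < G v v)
    {J : E →L[ℝ] E} (hJ : ∀ v w, G (J v) (J w) = G v w) (J_sq : ∀ v, J (J v) = -v)
    {ι : Type*} [Fintype ι] [DecidableEq ι] (e : Module.Basis ι ℝ E)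
    (he : ∀ i j, G (e i) (e j) = if i = j then 1 else 0) (B : E →L[ℝ] E →L[ℝ] ℝ) :
    ∑ i, B (J (e i)) (J (e i)) = ∑ i, B (e i) (e i) := by
  -- Since `J² = -1`, the inverse of `J` is `-J`. The basis `J e_i` is again orthonormal, and both
  -- sums equal the same `metricTrace`.
  let L : E ≃ₗ[ℝ] E := LinearEquiv.ofLinearMap (J : E →ₗ[ℝ] E) (-(J : E →ₗ[ℝ] E))
    (by ext v; simp [J_sq]) (by ext v; simp [J_sq])
  have h := metricTrace_eq_sum_clm pos (e.map L) (fun i j => (hJ (e i) (e j)).trans (he i j)) B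
  rw [metricTrace_eq_sum_clm pos e he B] at h
  exact h.symm

/-- Invariance of the trace under `J`, applied to `B(J·, ·)`, with `J² = -1`. This moves `J` between
the two slots of a trace at the cost of a sign. -/
theorem sum_isometry_left {G : E →L[ℝ] E →L[ℝ] ℝ} (pos : ∀ v, v ≠ 0 → 0 < G v v)
    {J : E →L[ℝ] E} (hJ : ∀ v w, G (J v) (J w) = G v w) (J_sq : ∀ v, J (J v) = -v)
    {ι : Type*} [Fintype ι] [DecidableEq ι] (e : Module.Basis ι ℝ E)
    (he : ∀ i j, G (e i) (e j) = if i = j then 1 else 0) (B : E →L[ℝ] E →L[ℝ] ℝ) :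
    ∑ i, B (J (e i)) (e i) = - ∑ i, B (e i) (J (e i)) := by
  have h := sum_isometry pos hJ J_sq e he (B.comp J)
  simp only [ContinuousLinearMap.comp_apply, J_sq, map_neg, neg_apply] at h
  rw [← h, ← Finset.sum_neg_distrib]

/-- Operator inversion is smooth at invertible maps, so this is what makes index raising
differentiable in the base point. -/
theorem isInvertible_of_pos {G : E →L[ℝ] E →L[ℝ] ℝ} (pos : ∀ v, v ≠ 0 → 0 < G v v) :
    G.IsInvertible := by
  refine ⟨ContinuousLinearEquiv.equivOfInverse G
    (LinearMap.toContinuousLinearMap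
      (IsLinearMap.mk' (sharp G) ⟨fun f h => ?_, fun c f => ?_⟩)) ?_ ?_, ?_⟩
  · simp [sharp]
  · simp [sharp]
  · intro v
    refine eq_of_inner_eq pos fun w => ?_
    change G (sharp G (G v)) w = _
    rw [inner_sharp G pos]
  · intro f
    exact inner_sharp G pos f
  · ext v w; rfl

/-- The trace commutes with a metric covariant derivative. -/
theorem fderiv_metricTrace {G : E → E →L[ℝ] E →L[ℝ] ℝ} {p : E}
    (hG : DifferentiableAt ℝ G p) (pos : ∀ᶠ z in 𝓝 p, ∀ v, v ≠ 0 → 0 < G z v v)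
    {X : E} {N : E →L[ℝ] E}
    (hN : ∀ v w, fderiv ℝ G p X v w = G p (N v) w + G p v (N w))
    {B : E → E →L[ℝ] E →L[ℝ] ℝ} (hB : DifferentiableAt ℝ B p) :
    fderiv ℝ (fun z => metricTrace (G z) (fun a b => B z a b)) p X =
      metricTrace (G p) (fun a b => fderiv ℝ B p X a b - B p (N a) b - B p a (N b)) := by
  have pp := pos.self_of_nhds
  let s : Fin (Module.finrank ℝ E) → E → E := fun i z => sharp (G z) (coordForm i)
  have hinv : DifferentiableAt ℝ (fun z => ContinuousLinearMap.inverse (G z)) p := by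
    obtain ⟨L, hL⟩ := isInvertible_of_pos pp
    have h1 : DifferentiableAt ℝ
        (ContinuousLinearMap.inverse : (E →L[ℝ] E →L[ℝ] ℝ) → ((E →L[ℝ] ℝ) →L[ℝ] E)) (G p) := by
      rw [← hL]
      exact (contDiffAt_map_inverse (n := 1) L).differentiableAt (by norm_num)
    exact DifferentiableAt.fun_comp' (𝕜 := ℝ) (F := E →L[ℝ] E →L[ℝ] ℝ) (G := (E →L[ℝ] ℝ) →L[ℝ] E) p h1 hG
  have hs : ∀ i, DifferentiableAt ℝ (s i) p := fun i =>
    hinv.clm_apply (differentiableAt_const _)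
  -- Differentiate `G z (s i z) = coordForm i`, whose right side is constant, and insert `hN` for
  -- the derivative of `G`.
  have hds : ∀ i, fderiv ℝ (s i) p X = - N (s i p) - sharp (G p) ((coordForm i).comp N) := by
    intro i
    refine eq_of_inner_eq pp fun w => ?_
    have h1 : (fun z => G z (s i z)) =ᶠ[𝓝 p] fun _ => coordForm i := by
      filter_upwards [pos] with z hz
      exact inner_sharp (G z) hz _
    have h2 := h1.fderiv_eq (𝕜 := ℝ)
    rw [fderiv_clm_apply hG (hs i)] at h2
    have h3 := congrArg (fun L : E →L[ℝ] E →L[ℝ] ℝ => L X w) h2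
    simp [hN] at h3
    have h4 : G p (s i p) (N w) = coordForm i (N w) := by
      rw [inner_sharp (G p) pp]
    simp [inner_sharp (G p) pp]
    linarith
  unfold metricTrace
  have hd : ∀ i, DifferentiableAt ℝ (fun z => B z (Module.finBasis ℝ E i) (s i z)) p :=
    fun i => (hB.clm_apply (differentiableAt_const _)).clm_apply (hs i)
  have hsum : (fun z => ∑ i, B z (Module.finBasis ℝ E i) (sharp (G z) (coordForm i))) =
      ∑ i, fun z => B z (Module.finBasis ℝ E i) (s i z) := by
    funext z; simp [s]
  rw [hsum, fderiv_sum (fun i _ => hd i)]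
  simp only [sum_apply, Finset.sum_sub_distrib]
  have hterm : ∀ i, fderiv ℝ (fun z => B z (Module.finBasis ℝ E i) (s i z)) p X =
      fderiv ℝ B p X (Module.finBasis ℝ E i) (s i p)
      - B p (Module.finBasis ℝ E i) (sharp (G p) ((coordForm i).comp N))
      - B p (Module.finBasis ℝ E i) (N (s i p)) := by
    intro i
    rw [fderiv_clm_apply (hB.clm_apply (differentiableAt_const _)) (hs i),
      fderiv_clm_apply hB (differentiableAt_const _)]
    simp [hds]
    ring
  rw [Finset.sum_congr rfl fun i _ => hterm i]
  simp only [Finset.sum_sub_distrib]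
  congr 2
  -- The second term of `hds` carries the transpose of `N`. Expanding it in the dual basis and
  -- exchanging the sums moves `N` onto the basis vector in the first slot of `B`.
  have hcomp : ∀ i, (coordForm i).comp N =
      ∑ j, coordForm i (N (Module.finBasis ℝ E j)) • coordForm (E := E) j := by
    intro i
    ext w
    conv_lhs => rw [← sum_coordForm_smul w]
    simp [map_sum, mul_comm]
  have h5 : ∀ i, B p (Module.finBasis ℝ E i) (sharp (G p) ((coordForm i).comp N)) =
      ∑ j, coordForm i (N (Module.finBasis ℝ E j)) *
        B p (Module.finBasis ℝ E i) (s j p) := by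
    intro i
    rw [hcomp]
    simp [sharp, s, map_sum]
  rw [Finset.sum_congr rfl fun i _ => h5 i, Finset.sum_comm]
  refine Finset.sum_congr rfl fun j _ => ?_
  conv_rhs => rw [← sum_coordForm_smul (N (Module.finBasis ℝ E j))]
  simp [map_sum, s]

end Algebra

/-! ### Curried multilinear maps and their exterior derivatives -/

section Multilinear

variable {E F F' : Type*} [NormedAddCommGroup E] [NormedSpace ℝ E]
  [NormedAddCommGroup F] [NormedSpace ℝ F] [NormedAddCommGroup F'] [NormedSpace ℝ F']

/-- Postcomposition of a bilinear map with a linear map. -/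
def post (L : F →L[ℝ] F') (B : E →L[ℝ] E →L[ℝ] F) : E →L[ℝ] E →L[ℝ] F' :=
  (ContinuousLinearMap.compL ℝ E F F' L).comp B

@[simp] theorem post_apply (L : F →L[ℝ] F') (B : E →L[ℝ] E →L[ℝ] F) (u v : E) :
    post L B u v = L (B u v) := rfl

/-- Precomposition of a linear form with an endomorphism. -/
def precomp (J : E →L[ℝ] E) : (E →L[ℝ] ℝ) →L[ℝ] (E →L[ℝ] ℝ) :=
  (ContinuousLinearMap.compL ℝ E E ℝ).flip J

@[simp] theorem precomp_apply (J : E →L[ℝ] E) (f : E →L[ℝ] ℝ) (v : E) :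
    precomp J f v = f (J v) := rfl

/-- The trilinear form `(u, v, w) ↦ D(w, u, v)`. -/
def cycle (D : E →L[ℝ] E →L[ℝ] E →L[ℝ] ℝ) : E →L[ℝ] E →L[ℝ] E →L[ℝ] ℝ :=
  ((ContinuousLinearMap.flipₗᵢ ℝ E E ℝ).toContinuousLinearEquiv :
    (E →L[ℝ] E →L[ℝ] ℝ) →L[ℝ] (E →L[ℝ] E →L[ℝ] ℝ)).comp D.flip

@[simp] theorem cycle_apply (D : E →L[ℝ] E →L[ℝ] E →L[ℝ] ℝ) (u v w : E) :
    cycle D u v w = D w u v := rfl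

theorem fderiv_apply_const {f : E → E →L[ℝ] F} {y : E} (h : DifferentiableAt ℝ f y) (u v : E) :
    fderiv ℝ (fun z => f z v) y u = fderiv ℝ f y u v := by
  rw [fderiv_clm_apply h (differentiableAt_const _)]
  simp

theorem fderiv_apply_const₂ {f : E → E →L[ℝ] E →L[ℝ] F} {y : E}
    (h : DifferentiableAt ℝ f y) (u v w : E) :
    fderiv ℝ (fun z => f z v w) y u = fderiv ℝ f y u v w := by
  rw [fderiv_apply_const (h.clm_apply (differentiableAt_const _)), fderiv_apply_const h]

theorem fderiv_apply_const₃ {f : E → E →L[ℝ] E →L[ℝ] E →L[ℝ] ℝ} {y : E}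
    (h : DifferentiableAt ℝ f y) (u v w x : E) :
    fderiv ℝ (fun z => f z v w x) y u = fderiv ℝ f y u v w x := by
  rw [fderiv_apply_const ((h.clm_apply (differentiableAt_const _)).clm_apply
    (differentiableAt_const _)), fderiv_apply_const₂ h]

theorem extD_two {α : E → E →L[ℝ] E →L[ℝ] ℝ} {y : E} (h : DifferentiableAt ℝ α y)
    (v : Fin 3 → E) :
    extD (fun z (v : Fin 2 → E) => α z (v 0) (v 1)) y v =
      fderiv ℝ α y (v 0) (v 1) (v 2) - fderiv ℝ α y (v 1) (v 0) (v 2)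
        + fderiv ℝ α y (v 2) (v 0) (v 1) := by
  simp only [extD, fderiv_apply_const₂ h]
  simp [Fin.sum_univ_three, Fin.removeNth, Fin.succAbove]
  ring

theorem extD_three {α : E → E →L[ℝ] E →L[ℝ] E →L[ℝ] ℝ} {y : E} (h : DifferentiableAt ℝ α y)
    (a b c d : E) :
    extD (fun z (v : Fin 3 → E) => α z (v 0) (v 1) (v 2)) y ![a, b, c, d] =
      fderiv ℝ α y a b c d - fderiv ℝ α y b a c d + fderiv ℝ α y c a b d
        - fderiv ℝ α y d a b c := by
  simp only [extD, fderiv_apply_const₃ h]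
  simp [Fin.sum_univ_four, Fin.removeNth, Fin.succAbove]
  ring

end Multilinear

/-! ### Pointwise algebra of `∇^g J` and of the torsion form -/

section LinearHermitian

variable {E : Type*} [NormedAddCommGroup E] [NormedSpace ℝ E]

/-- Pointwise data: `P = ∇^g J` at a point of a Hermitian vector space `(G, J)`. -/
structure NablaJ (G : E →L[ℝ] E →L[ℝ] ℝ) (J : E →L[ℝ] E) (P : E →L[ℝ] E →L[ℝ] E) : Prop where
  symm : ∀ v w, G v w = G w v
  pos : ∀ v, v ≠ 0 → 0 < G v v
  J_sq : ∀ v, J (J v) = -v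
  compat : ∀ v w, G (J v) (J w) = G v w
  skew : ∀ u v w, G (P u v) w = - G v (P u w)
  anti : ∀ u v, P u (J v) = - J (P u v)
  nij : ∀ u v, P (J u) v - P (J v) u + J (P v u) - J (P u v) = 0

namespace NablaJ

variable {G : E →L[ℝ] E →L[ℝ] ℝ} {J : E →L[ℝ] E} {P : E →L[ℝ] E →L[ℝ] E}

theorem inner_J_left (h : NablaJ G J P) (v w : E) : G (J v) w = - G v (J w) := by
  have := h.compat v (J w)
  rw [h.J_sq, map_neg] at this
  linarith

/-- Integrability makes `∇^g J` complex linear in the direction of differentiation. -/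
theorem map_J (h : NablaJ G J P) (u v : E) : P (J u) v = J (P u v) := by
  -- Put `q(a,b,c) = g(P_{Ja} b - J P_a b, c)`. Vanishing of the Nijenhuis tensor makes `q`
  -- symmetric in `a,b`, and `hk` makes it skew in `b,c`. A trilinear form with both symmetries is
  -- zero.
  have hs : ∀ a b c, G (P (J a) b - J (P a b)) c = G (P (J b) a - J (P b a)) c := by
    intro a b c
    have := congrArg (fun x => G x c) (h.nij a b)
    simp at this ⊢
    linarith
  have hk : ∀ a b c, G (P (J a) b - J (P a b)) c = - G (P (J a) c - J (P a c)) b := by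
    intro a b c
    have h1 := h.skew (J a) b c
    have h2 : G (J (P a b)) c = - G (P a b) (J c) := h.inner_J_left _ _
    have h3 := h.skew a b (J c)
    have h4 : G b (P a (J c)) = - G b (J (P a c)) := by rw [h.anti]; simp
    have h5 := h.symm b (P (J a) c)
    have h6 := h.symm b (J (P a c))
    simp only [map_sub, sub_apply]
    linarith
  refine eq_of_inner_eq h.pos fun w => ?_
  have e : G (P (J u) v - J (P u v)) w = 0 := by
    have := hs u v w
    have := hk v u w
    have := hs v w u
    have := hk w v u
    have := hs w u v
    have := hk u w v
    linarith
  simpa [sub_eq_zero] using e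

/-- The torsion form in terms of `a(u; v, w) = g(v, (∇^g_u J) w)`. -/
theorem sum_apply_J (h : NablaJ G J P) {τ : E → E → E → ℝ}
    (hτ : ∀ u v w, τ u v w = -(G (J v) (P (J u) (J w)) - G (J u) (P (J v) (J w))
      + G (J u) (P (J w) (J v)))) (u v w : E) :
    τ u (J w) v + τ u w (J v) = - 2 * G v (P u w) := by
  -- `map_J` and `anti` pull every `J` out of `P`, leaving terms `g(·, P_· ·)` without `J`; skewness
  -- of `P` then suffices.
  simp only [hτ, h.map_J, h.anti, h.J_sq, h.inner_J_left, map_neg, neg_apply, neg_neg]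
  have := h.skew u v w
  have := h.skew v u w
  have := h.skew w u v
  have := h.symm v (P u w)
  have := h.symm (P u v) w
  have := h.symm u (P v w)
  have := h.symm (P v u) w
  have := h.symm u (P w v)
  have := h.symm (P w u) v
  linarith

/-- For a single term `A = g(v, P_u w)`, inserting `J` at two slots preserves `A` when `u` is one of
them and changes its sign otherwise. The three choices add up to `A`, and the same count applies to
each summand of `τ`. -/
theorem type_condition (h : NablaJ G J P) {τ : E → E → E → ℝ}
    (hτ : ∀ u v w, τ u v w = -(G (J v) (P (J u) (J w)) - G (J u) (P (J v) (J w))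
      + G (J u) (P (J w) (J v)))) (u v w : E) :
    τ u v w = τ (J u) (J v) w + τ (J u) v (J w) + τ u (J v) (J w) := by
  simp only [hτ, h.map_J, h.anti, h.J_sq, h.inner_J_left, map_neg, neg_apply, neg_neg]
  ring

theorem form_skew₁ (h : NablaJ G J P) {τ : E → E → E → ℝ}
    (hτ : ∀ u v w, τ u v w = -(G (J v) (P (J u) (J w)) - G (J u) (P (J v) (J w))
      + G (J u) (P (J w) (J v)))) (u v w : E) : τ u v w = - τ v u w := by
  have h1 := h.skew (J w) (J u) (J v)
  have h2 := h.symm (P (J w) (J u)) (J v)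
  rw [hτ, hτ]
  linarith

theorem form_skew₂ (h : NablaJ G J P) {τ : E → E → E → ℝ}
    (hτ : ∀ u v w, τ u v w = -(G (J v) (P (J u) (J w)) - G (J u) (P (J v) (J w))
      + G (J u) (P (J w) (J v)))) (u v w : E) : τ u v w = - τ u w v := by
  have h1 := h.skew (J u) (J v) (J w)
  have h2 := h.symm (P (J u) (J v)) (J w)
  rw [hτ, hτ]
  linarith

end NablaJ
end LinearHermitian

/-! ### Smooth Hermitian structures on an open set and their connection coefficients -/

section Fields

variable {E : Type*} [NormedAddCommGroup E] [NormedSpace ℝ E]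

/-- A smooth Hermitian structure on an open subset of a vector space. -/
structure IsHermitianOn (G : E → E →L[ℝ] E →L[ℝ] ℝ) (J : E → E →L[ℝ] E) (U : Set E) : Prop where
  isOpen : IsOpen U
  smooth_G : ContDiffOn ℝ ∞ G U
  smooth_J : ContDiffOn ℝ ∞ J U
  symm : ∀ z ∈ U, ∀ v w, G z v w = G z w v
  pos : ∀ z ∈ U, ∀ v, v ≠ 0 → 0 < G z v v
  J_sq : ∀ z ∈ U, ∀ v, J z (J z v) = -v
  compat : ∀ z ∈ U, ∀ v w, G z (J z v) (J z w) = G z v w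
  nij : ∀ z ∈ U, ∀ u v, nijenhuis J z u v = 0

/-- The Levi-Civita connection with its last index lowered. -/
def lcForm (G : E → E →L[ℝ] E →L[ℝ] ℝ) (z : E) : E →L[ℝ] E →L[ℝ] E →L[ℝ] ℝ :=
  (1 / 2 : ℝ) • (fderiv ℝ G z + (fderiv ℝ G z).flip - cycle (fderiv ℝ G z))

/-- The Christoffel symbols as a bilinear map. -/
def christoffel (G : E → E →L[ℝ] E →L[ℝ] ℝ) (z : E) : E →L[ℝ] E →L[ℝ] E :=
  post (ContinuousLinearMap.inverse (G z)) (lcForm G z)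

/-- The Kähler form as a bilinear map. -/
def kahlerMap (G : E → E →L[ℝ] E →L[ℝ] ℝ) (J : E → E →L[ℝ] E) (z : E) : E →L[ℝ] E →L[ℝ] ℝ :=
  (precomp (J z)).comp (G z)

@[simp] theorem kahlerMap_apply (G : E → E →L[ℝ] E →L[ℝ] ℝ) (J : E → E →L[ℝ] E) (z u v : E) :
    kahlerMap G J z u v = G z u (J z v) := rfl

/-- The exterior derivative of the Kähler form as a trilinear map. -/
def dKahlerMap (G : E → E →L[ℝ] E →L[ℝ] ℝ) (J : E → E →L[ℝ] E) (z : E) :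
    E →L[ℝ] E →L[ℝ] E →L[ℝ] ℝ :=
  fderiv ℝ (kahlerMap G J) z - (fderiv ℝ (kahlerMap G J) z).flip
    + cycle (fderiv ℝ (kahlerMap G J) z)

theorem dKahlerMap_apply (G : E → E →L[ℝ] E →L[ℝ] ℝ) (J : E → E →L[ℝ] E) (z u v w : E) :
    dKahlerMap G J z u v w = fderiv ℝ (kahlerMap G J) z u v w
      - fderiv ℝ (kahlerMap G J) z v u w + fderiv ℝ (kahlerMap G J) z w u v := rfl

/-- The form `d^c Ω` as a trilinear map. -/
def dcMap (G : E → E →L[ℝ] E →L[ℝ] ℝ) (J : E → E →L[ℝ] E) (z : E) :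
    E →L[ℝ] E →L[ℝ] E →L[ℝ] ℝ :=
  - post (precomp (J z)) ((dKahlerMap G J z).bilinearComp (J z) (J z))

theorem dcMap_apply (G : E → E →L[ℝ] E →L[ℝ] ℝ) (J : E → E →L[ℝ] E) (z u v w : E) :
    dcMap G J z u v w = - dKahlerMap G J z (J z u) (J z v) (J z w) := rfl

/-- The torsion of the Bismut connection as a bilinear map. -/
def torsionMap (G : E → E →L[ℝ] E →L[ℝ] ℝ) (J : E → E →L[ℝ] E) (z : E) : E →L[ℝ] E →L[ℝ] E :=
  post (ContinuousLinearMap.inverse (G z)) (dcMap G J z)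

/-- The Bismut connection as a bilinear map. -/
def bismutMap (G : E → E →L[ℝ] E →L[ℝ] ℝ) (J : E → E →L[ℝ] E) (z : E) : E →L[ℝ] E →L[ℝ] E :=
  christoffel G z + (1 / 2 : ℝ) • torsionMap G J z

theorem bismutMap_apply (G : E → E →L[ℝ] E →L[ℝ] ℝ) (J : E → E →L[ℝ] E) (z u v : E) :
    bismutMap G J z u v = christoffel G z u v + (1 / 2 : ℝ) • torsionMap G J z u v := rfl

/-- The covariant derivative `(∇^g_u J) v`. -/
def nablaJ (G : E → E →L[ℝ] E →L[ℝ] ℝ) (J : E → E →L[ℝ] E) (z : E) : E →L[ℝ] E →L[ℝ] E :=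
  fderiv ℝ J z + (christoffel G z).bilinearComp (ContinuousLinearMap.id ℝ E) (J z)
    - post (J z) (christoffel G z)

theorem nablaJ_apply (G : E → E →L[ℝ] E →L[ℝ] ℝ) (J : E → E →L[ℝ] E) (z u v : E) :
    nablaJ G J z u v = fderiv ℝ J z u v + christoffel G z u (J z v)
      - J z (christoffel G z u v) := rfl

namespace IsHermitianOn

variable {G : E → E →L[ℝ] E →L[ℝ] ℝ} {J : E → E →L[ℝ] E} {U : Set E}

theorem diff_G (h : IsHermitianOn G J U) {z : E} (hz : z ∈ U) : DifferentiableAt ℝ G z :=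
  (h.smooth_G.contDiffAt (h.isOpen.mem_nhds hz)).differentiableAt (by norm_num)

theorem diff_J (h : IsHermitianOn G J U) {z : E} (hz : z ∈ U) : DifferentiableAt ℝ J z :=
  (h.smooth_J.contDiffAt (h.isOpen.mem_nhds hz)).differentiableAt (by norm_num)

theorem smooth_fderiv (h : IsHermitianOn G J U) {F : Type*} [NormedAddCommGroup F]
    [NormedSpace ℝ F] {f : E → F} (hf : ContDiffOn ℝ ∞ f U) : ContDiffOn ℝ ∞ (fderiv ℝ f) U :=
  hf.fderiv_of_isOpen h.isOpen le_rfl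

theorem diff_of_smooth (h : IsHermitianOn G J U) {F : Type*} [NormedAddCommGroup F]
    [NormedSpace ℝ F] {f : E → F} (hf : ContDiffOn ℝ ∞ f U) {z : E} (hz : z ∈ U) :
    DifferentiableAt ℝ f z :=
  (hf.contDiffAt (h.isOpen.mem_nhds hz)).differentiableAt (by norm_num)

theorem eventually (h : IsHermitianOn G J U) {z : E} (hz : z ∈ U) : ∀ᶠ y in 𝓝 z, y ∈ U :=
  h.isOpen.mem_nhds hz

theorem fderiv_G_symm (h : IsHermitianOn G J U) {z : E} (hz : z ∈ U) (u v w : E) :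
    fderiv ℝ G z u v w = fderiv ℝ G z u w v := by
  have e : (fun y => G y v w) =ᶠ[𝓝 z] fun y => G y w v := by
    filter_upwards [h.isOpen.mem_nhds hz] with y hy
    exact h.symm y hy v w
  have := congrArg (fun L : E →L[ℝ] ℝ => L u) (e.fderiv_eq (𝕜 := ℝ))
  simpa only [fderiv_apply_const₂ (h.diff_G hz)] using this

theorem fderiv_J_anti (h : IsHermitianOn G J U) {z : E} (hz : z ∈ U) (u v : E) :
    fderiv ℝ J z u (J z v) = - J z (fderiv ℝ J z u v) := by
  have e : (fun y => J y (J y v)) =ᶠ[𝓝 z] fun _ => -v := by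
    filter_upwards [h.isOpen.mem_nhds hz] with y hy
    exact h.J_sq y hy v
  have hJ := h.diff_J hz
  have := congrArg (fun L : E →L[ℝ] E => L u) (e.fderiv_eq (𝕜 := ℝ))
  simp only [fderiv_clm_apply hJ (hJ.clm_apply (differentiableAt_const v))] at this
  simp [fderiv_apply_const hJ] at this
  rw [eq_neg_iff_add_eq_zero, add_comm]
  exact this

theorem fderiv_compat (h : IsHermitianOn G J U) {z : E} (hz : z ∈ U) (u v w : E) :
    fderiv ℝ G z u (J z v) (J z w) + G z (fderiv ℝ J z u v) (J z w)
      + G z (J z v) (fderiv ℝ J z u w) = fderiv ℝ G z u v w := by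
  have e : (fun y => G y (J y v) (J y w)) =ᶠ[𝓝 z] fun y => G y v w := by
    filter_upwards [h.isOpen.mem_nhds hz] with y hy
    exact h.compat y hy v w
  have hJ := h.diff_J hz
  have hG := h.diff_G hz
  have hJc : ∀ v, DifferentiableAt ℝ (fun y => J y v) z := fun v =>
    hJ.clm_apply (differentiableAt_const v)
  have := congrArg (fun L : E →L[ℝ] ℝ => L u) (e.fderiv_eq (𝕜 := ℝ))
  simp only [fderiv_clm_apply (hG.clm_apply (hJc v)) (hJc w), fderiv_clm_apply hG (hJc v),
    fderiv_apply_const₂ hG] at this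
  simp [fderiv_apply_const hJ] at this
  linarith

end IsHermitianOn

variable [FiniteDimensional ℝ E]

theorem contDiffOn_clm_apply₂ {F : Type*} [NormedAddCommGroup F] [NormedSpace ℝ F]
    {f : E → E →L[ℝ] E →L[ℝ] F} {U : Set E} {n : WithTop ℕ∞}
    (h : ∀ u v, ContDiffOn ℝ n (fun z => f z u v) U) : ContDiffOn ℝ n f U :=
  contDiffOn_clm_apply.2 fun u => contDiffOn_clm_apply.2 fun v => h u v

namespace IsHermitianOn

variable {G : E → E →L[ℝ] E →L[ℝ] ℝ} {J : E → E →L[ℝ] E} {U : Set E}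

theorem smooth_inverse (h : IsHermitianOn G J U) :
    ContDiffOn ℝ ∞ (fun z => ContinuousLinearMap.inverse (G z)) U := by
  intro z hz
  obtain ⟨L, hL⟩ := isInvertible_of_pos (h.pos z hz)
  have h1 : ContDiffAt ℝ ∞
      (ContinuousLinearMap.inverse : (E →L[ℝ] E →L[ℝ] ℝ) → ((E →L[ℝ] ℝ) →L[ℝ] E)) (G z) := by
    rw [← hL]
    exact contDiffAt_map_inverse L
  exact h1.comp_contDiffWithinAt z (h.smooth_G z hz)

theorem smooth_christoffel (h : IsHermitianOn G J U) : ContDiffOn ℝ ∞ (christoffel G) U := by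
  have hd := h.smooth_fderiv h.smooth_G
  refine contDiffOn_clm_apply₂ fun u v => h.smooth_inverse.clm_apply
    (contDiffOn_clm_apply.2 fun w => ?_)
  have e : ∀ a b c : E, ContDiffOn ℝ ∞ (fun z => fderiv ℝ G z a b c) U := fun a b c =>
    ((hd.clm_apply contDiffOn_const).clm_apply contDiffOn_const).clm_apply contDiffOn_const
  exact contDiffOn_const.mul (((e u v w).add (e v u w)).sub (e w u v))

theorem smooth_kahler (h : IsHermitianOn G J U) : ContDiffOn ℝ ∞ (kahlerMap G J) U :=
  contDiffOn_clm_apply₂ fun _ _ =>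
    (h.smooth_G.clm_apply contDiffOn_const).clm_apply (h.smooth_J.clm_apply contDiffOn_const)

theorem smooth_dc (h : IsHermitianOn G J U) : ContDiffOn ℝ ∞ (dcMap G J) U := by
  have hd := h.smooth_fderiv h.smooth_kahler
  refine contDiffOn_clm_apply₂ fun u v => contDiffOn_clm_apply.2 fun w => ?_
  have e : ∀ a b c : E, ContDiffOn ℝ ∞
      (fun z => fderiv ℝ (kahlerMap G J) z (J z a) (J z b) (J z c)) U := fun a b c =>
    ((hd.clm_apply (h.smooth_J.clm_apply contDiffOn_const)).clm_apply
      (h.smooth_J.clm_apply contDiffOn_const)).clm_apply (h.smooth_J.clm_apply contDiffOn_const)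
  exact (((e u v w).sub (e v u w)).add (e w u v)).neg

theorem smooth_torsion (h : IsHermitianOn G J U) : ContDiffOn ℝ ∞ (torsionMap G J) U :=
  contDiffOn_clm_apply₂ fun _ _ => h.smooth_inverse.clm_apply
    ((h.smooth_dc.clm_apply contDiffOn_const).clm_apply contDiffOn_const)

theorem smooth_bismut (h : IsHermitianOn G J U) : ContDiffOn ℝ ∞ (bismutMap G J) U :=
  h.smooth_christoffel.add (h.smooth_torsion.const_smul (1 / 2 : ℝ))

theorem inner_christoffel (h : IsHermitianOn G J U) {z : E} (hz : z ∈ U) (u v w : E) :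
    G z (christoffel G z u v) w =
      (1 / 2 : ℝ) * (fderiv ℝ G z u v w + fderiv ℝ G z v u w - fderiv ℝ G z w u v) :=
  congrArg (fun f : E →L[ℝ] ℝ => f w) (inner_sharp (G z) (h.pos z hz) (lcForm G z u v))

theorem inner_torsionMap (h : IsHermitianOn G J U) {z : E} (hz : z ∈ U) (u v w : E) :
    G z (torsionMap G J z u v) w = dcMap G J z u v w :=
  congrArg (fun f : E →L[ℝ] ℝ => f w) (inner_sharp (G z) (h.pos z hz) (dcMap G J z u v))

theorem christoffel_symm (h : IsHermitianOn G J U) {z : E} (hz : z ∈ U) (u v : E) :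
    christoffel G z u v = christoffel G z v u := by
  refine eq_of_inner_eq (h.pos z hz) fun w => ?_
  rw [h.inner_christoffel hz, h.inner_christoffel hz, h.fderiv_G_symm hz w u v]
  ring

theorem christoffel_metric (h : IsHermitianOn G J U) {z : E} (hz : z ∈ U) (u v w : E) :
    fderiv ℝ G z u v w = G z (christoffel G z u v) w + G z v (christoffel G z u w) := by
  rw [h.symm z hz v, h.inner_christoffel hz, h.inner_christoffel hz, h.fderiv_G_symm hz u w v,
    h.fderiv_G_symm hz w u v, h.fderiv_G_symm hz v u w]
  ring

theorem fderiv_kahler (h : IsHermitianOn G J U) {z : E} (hz : z ∈ U) (u v w : E) :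
    fderiv ℝ (kahlerMap G J) z u v w = fderiv ℝ G z u v (J z w) + G z v (fderiv ℝ J z u w) := by
  have hJ := h.diff_J hz
  have hG := h.diff_G hz
  rw [← fderiv_apply_const₂ (h.diff_of_smooth h.smooth_kahler hz)]
  simp only [kahlerMap_apply]
  rw [fderiv_clm_apply (hG.clm_apply (differentiableAt_const _))
    (hJ.clm_apply (differentiableAt_const _))]
  simp [fderiv_apply_const hJ, fderiv_apply_const hG]
  ring

theorem nablaJ_spec (h : IsHermitianOn G J U) {z : E} (hz : z ∈ U) :
    NablaJ (G z) (J z) (nablaJ G J z) where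
  symm := h.symm z hz
  pos := h.pos z hz
  J_sq := h.J_sq z hz
  compat := h.compat z hz
  skew := by
    intro u v w
    have hJ : ∀ v w, G z (J z v) w = - G z v (J z w) := by
      intro v w
      have := h.compat z hz v (J z w)
      rw [h.J_sq z hz, map_neg] at this
      linarith
    -- With `Jw` in the last slot, `J² = -1` turns the derivative of compatibility into a statement
    -- on `∂J` without a remaining `J` beside it.
    have h1 := h.fderiv_compat hz u v (J z w)
    rw [h.fderiv_J_anti hz, h.J_sq z hz, map_neg, map_neg, map_neg, hJ, h.J_sq z hz,
      map_neg] at h1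
    have h2 := h.christoffel_metric hz u (J z v) w
    have h3 := h.christoffel_metric hz u v (J z w)
    have h4 := hJ v (christoffel G z u w)
    have h5 := hJ (christoffel G z u v) w
    simp only [nablaJ_apply, map_add, map_sub, add_apply, sub_apply]
    linarith
  anti := by
    intro u v
    simp only [nablaJ_apply, h.fderiv_J_anti hz, h.J_sq z hz, map_neg, map_add, map_sub]
    abel
  nij := by
    intro u v
    have hJ := h.diff_J hz
    -- On constant fields the brackets contain only `∂J`. The symmetry of the Christoffel symbols
    -- lets `∇^g J` replace `∂J`.
    have h1 := h.nij z hz u v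
    simp only [nijenhuis, VectorField.lieBracket, fderiv_apply_const hJ] at h1
    simp at h1
    simp only [nablaJ_apply, map_add, map_sub, h.J_sq z hz]
    rw [← h1, h.christoffel_symm hz (J z u) (J z v), h.christoffel_symm hz (J z u) v,
      h.christoffel_symm hz (J z v) u, h.christoffel_symm hz u v]
    abel

end IsHermitianOn
end Fields

/-! ### Curvature and covariant derivatives in coordinates -/

section Connection

variable {E : Type*} [NormedAddCommGroup E] [NormedSpace ℝ E]

/-- The curvature of a connection, as a trilinear map. -/
def curvMap (B : E → E →L[ℝ] E →L[ℝ] E) (z : E) : E →L[ℝ] E →L[ℝ] E →L[ℝ] E :=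
  (fderiv ℝ B z + (ContinuousLinearMap.compL ℝ E E E).bilinearComp (B z) (B z))
    - (fderiv ℝ B z + (ContinuousLinearMap.compL ℝ E E E).bilinearComp (B z) (B z)).flip

theorem curvMap_apply (B : E → E →L[ℝ] E →L[ℝ] E) (z u v w : E) :
    curvMap B z u v w = (fderiv ℝ B z u v w + B z u (B z v w))
      - (fderiv ℝ B z v u w + B z v (B z u w)) := rfl

theorem curvMap_skew (B : E → E →L[ℝ] E →L[ℝ] E) (z u v w : E) :
    curvMap B z u v w = - curvMap B z v u w := by
  simp only [curvMap_apply]; abel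

/-- Constant fields commute, so the bracket term drops. Agreement of `A` and `B` is needed near `y`
because the coefficients are differentiated. -/
theorem curvature_eq_curvMap {A : E → E → E → E} {B : E → E →L[ℝ] E →L[ℝ] E} {y : E}
    (hAB : ∀ᶠ z in 𝓝 y, ∀ u v, A z u v = B z u v) (hB : DifferentiableAt ℝ B y) (u v w : E) :
    curvature A y u v w = curvMap B y u v w := by
  have h0 : ∀ a b : E, covAlong A (fun _ => a) (fun _ => b) = fun z => A z a b := by
    intro a b; funext z; simp [covAlong]
  have hf : ∀ a b c, fderiv ℝ (fun z => A z a b) y c = fderiv ℝ B y c a b := by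
    intro a b c
    have e : (fun z => A z a b) =ᶠ[𝓝 y] fun z => B z a b := by
      filter_upwards [hAB] with z hz using hz a b
    rw [e.fderiv_eq, fderiv_apply_const₂ hB]
  have hy := hAB.self_of_nhds
  have hl : VectorField.lieBracket ℝ (fun _ => u) (fun _ => v) = fun _ : E => (0 : E) := by
    funext z; simp [VectorField.lieBracket]
  rw [curvature, curvatureField, h0, h0, hl]
  simp [covAlong, hf, hy, curvMap_apply]

theorem torsion_eq (A : E → E → E → E) (y u v : E) : torsion A y u v = A y u v - A y v u := by
  simp [torsion, torsionField, covAlong, VectorField.lieBracket]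

/-- The covariant derivative of a trilinear form. -/
def covMap (B : E → E →L[ℝ] E →L[ℝ] E) (τ : E → E →L[ℝ] E →L[ℝ] E →L[ℝ] ℝ) (z : E) :
    E →L[ℝ] E →L[ℝ] E →L[ℝ] E →L[ℝ] ℝ :=
  fderiv ℝ τ z - post (τ z) (B z)
    - ((ContinuousLinearMap.compL ℝ E E (E →L[ℝ] ℝ)).bilinearComp (τ z) (B z)).flip
    - ((ContinuousLinearMap.compL ℝ E (E →L[ℝ] E →L[ℝ] ℝ) (E →L[ℝ] E →L[ℝ] ℝ)).flip (τ z)).comp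
        ((ContinuousLinearMap.compL ℝ E (E →L[ℝ] ℝ) (E →L[ℝ] ℝ)).comp
          ((ContinuousLinearMap.compL ℝ E E ℝ).flip.comp (B z)))

theorem covMap_apply (B : E → E →L[ℝ] E →L[ℝ] E) (τ : E → E →L[ℝ] E →L[ℝ] E →L[ℝ] ℝ)
    (z u a b c : E) :
    covMap B τ z u a b c = fderiv ℝ τ z u a b c - τ z (B z u a) b c - τ z a (B z u b) c
      - τ z a b (B z u c) := rfl

theorem covTensor_three {A : E → E → E → E} {B : E → E →L[ℝ] E →L[ℝ] E}
    {τ : E → E →L[ℝ] E →L[ℝ] E →L[ℝ] ℝ} {α : E → (Fin 3 → E) → ℝ} {y : E}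
    (hA : ∀ u v, A y u v = B y u v) (hτ : DifferentiableAt ℝ τ y)
    (hα : ∀ᶠ z in 𝓝 y, ∀ v, α z v = τ z (v 0) (v 1) (v 2)) (u a b c : E) :
    covTensor A α y u ![a, b, c] = covMap B τ y u a b c := by
  have e : (fun z => α z ![a, b, c]) =ᶠ[𝓝 y] fun z => τ z a b c := by
    filter_upwards [hα] with z hz using hz _
  rw [covTensor, e.fderiv_eq, fderiv_apply_const₃ hτ, covMap_apply]
  simp [hα.self_of_nhds, Fin.sum_univ_three, hA]
  ring

/-- The curvature of a metric connection is skew in its last two arguments. -/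
theorem curvMap_metric {G : E → E →L[ℝ] E →L[ℝ] ℝ} {B : E → E →L[ℝ] E →L[ℝ] E} {y : E}
    (hG : ContDiffAt ℝ ∞ G y) (hB : DifferentiableAt ℝ B y)
    (h : ∀ᶠ z in 𝓝 y, ∀ u v w, fderiv ℝ G z u v w = G z (B z u v) w + G z v (B z u w))
    (x u v w : E) : G y (curvMap B y x u v) w = - G y v (curvMap B y x u w) := by
  have hd := hG.differentiableAt (by norm_num)
  have hdd : DifferentiableAt ℝ (fderiv ℝ G) y :=
    (hG.fderiv_right (m := 1) (by norm_cast)).differentiableAt (by norm_num)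
  have hy := h.self_of_nhds
  have hBc : ∀ a b, DifferentiableAt ℝ (fun z => B z a b) y := fun a b =>
    (hB.clm_apply (differentiableAt_const a)).clm_apply (differentiableAt_const b)
  have key : ∀ x u, fderiv ℝ (fderiv ℝ G) y x u v w =
      G y (B y x (B y u v)) w + G y (B y u v) (B y x w) + G y (fderiv ℝ B y x u v) w
      + (G y (B y x v) (B y u w) + G y v (B y x (B y u w)) + G y v (fderiv ℝ B y x u w)) := by
    intro x u
    have e : (fun z => fderiv ℝ G z u v w) =ᶠ[𝓝 y]
        fun z => G z (B z u v) w + G z v (B z u w) := by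
      filter_upwards [h] with z hz using hz u v w
    rw [← fderiv_apply_const₃ hdd, e.fderiv_eq, fderiv_fun_add
      ((hd.clm_apply (hBc u v)).clm_apply (differentiableAt_const w))
      ((hd.clm_apply (differentiableAt_const v)).clm_apply (hBc u w)),
      fderiv_clm_apply (hd.clm_apply (hBc u v)) (differentiableAt_const w),
      fderiv_clm_apply hd (hBc u v),
      fderiv_clm_apply (hd.clm_apply (differentiableAt_const v)) (hBc u w)]
    simp [fderiv_apply_const₂ hB, fderiv_apply_const hd, hy]
    ring
  -- Antisymmetrizing `key` in `x, u` kills the second derivative and the mixed terms `g(B_x v, B_u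
  -- w) + g(B_u v, B_x w)`; what is left is the curvature in each slot.
  have hs := hG.isSymmSndFDerivAt (by simpa using WithTop.coe_le_coe.2 (le_top : (2 : ℕ∞) ≤ ⊤)) x u
  have hs' := congrArg (fun L : E →L[ℝ] E →L[ℝ] ℝ => L v w) hs
  simp only [key] at hs'
  simp only [curvMap_apply, map_add, map_sub, add_apply, sub_apply]
  linarith

/-- The curvature of a connection with `∇J = 0` commutes with `J`. -/
theorem curvMap_J {J : E → E →L[ℝ] E} {B : E → E →L[ℝ] E →L[ℝ] E} {y : E}
    (hJ : ContDiffAt ℝ ∞ J y) (hB : DifferentiableAt ℝ B y)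
    (h : ∀ᶠ z in 𝓝 y, ∀ u v, fderiv ℝ J z u v = J z (B z u v) - B z u (J z v))
    (x u v : E) : curvMap B y x u (J y v) = J y (curvMap B y x u v) := by
  have hd := hJ.differentiableAt (by norm_num)
  have hdd : DifferentiableAt ℝ (fderiv ℝ J) y :=
    (hJ.fderiv_right (m := 1) (by norm_cast)).differentiableAt (by norm_num)
  have hy := h.self_of_nhds
  have hB1 : ∀ a, DifferentiableAt ℝ (fun z => B z a) y := fun a =>
    hB.clm_apply (differentiableAt_const a)
  have hBc : ∀ a b, DifferentiableAt ℝ (fun z => B z a b) y := fun a b =>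
    (hB1 a).clm_apply (differentiableAt_const b)
  have hJc : DifferentiableAt ℝ (fun z => J z v) y := hd.clm_apply (differentiableAt_const v)
  have key : ∀ x u, fderiv ℝ (fderiv ℝ J) y x u v =
      J y (B y x (B y u v)) - B y x (J y (B y u v)) + J y (fderiv ℝ B y x u v)
      - (fderiv ℝ B y x u (J y v) + B y u (J y (B y x v)) - B y u (B y x (J y v))) := by
    intro x u
    have e : (fun z => fderiv ℝ J z u v) =ᶠ[𝓝 y]
        fun z => J z (B z u v) - B z u (J z v) := by
      filter_upwards [h] with z hz using hz u v
    rw [← fderiv_apply_const₂ hdd, e.fderiv_eq, fderiv_fun_sub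
      (hd.clm_apply (hBc u v)) ((hB1 u).clm_apply hJc),
      fderiv_clm_apply hd (hBc u v), fderiv_clm_apply (hB1 u) hJc]
    simp [fderiv_apply_const₂ hB, fderiv_apply_const hd, fderiv_apply_const hB, hy]
    abel
  -- As for the metric: the mixed terms `B_x J B_u v + B_u J B_x v` are symmetric and cancel.
  have hs := hJ.isSymmSndFDerivAt (by simpa using WithTop.coe_le_coe.2 (le_top : (2 : ℕ∞) ≤ ⊤)) x u
  have hs' := congrArg (fun L : E →L[ℝ] E => L v) hs
  simp only [key] at hs'
  simp only [curvMap_apply, map_add, map_sub]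
  rw [← sub_eq_zero] at hs' ⊢
  rw [← neg_eq_zero, ← hs']
  abel

/-- The first Bianchi identity of a torsion free connection. -/
theorem curvMap_bianchi {B : E → E →L[ℝ] E →L[ℝ] E} {y : E} (hB : DifferentiableAt ℝ B y)
    (h : ∀ᶠ z in 𝓝 y, ∀ u v, B z u v = B z v u) (u v w : E) :
    curvMap B y u v w + curvMap B y v w u + curvMap B y w u v = 0 := by
  have hy := h.self_of_nhds
  have hs : ∀ x a b, fderiv ℝ B y x a b = fderiv ℝ B y x b a := by
    intro x a b
    have e : (fun z => B z a b) =ᶠ[𝓝 y] fun z => B z b a := by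
      filter_upwards [h] with z hz using hz a b
    rw [← fderiv_apply_const₂ hB, e.fderiv_eq, fderiv_apply_const₂ hB]
  simp only [curvMap_apply]
  rw [hs u w v, hs v u w, hs w v u, hy w v, hy u w, hy v u]
  abel

/-- Change of the curvature under `A = Γ + ½ K`. -/
theorem curvMap_add {B A K : E → E →L[ℝ] E →L[ℝ] E} {y : E}
    (hB : DifferentiableAt ℝ B y) (hK : DifferentiableAt ℝ K y)
    (hA : ∀ z u v, A z u v = B z u v + (1 / 2 : ℝ) • K z u v)
    (u v w : E) :
    curvMap A y u v w = curvMap B y u v w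
      + (1 / 2 : ℝ) • ((fderiv ℝ K y u v w + B y u (K y v w) - K y v (B y u w))
        - (fderiv ℝ K y v u w + B y v (K y u w) - K y u (B y v w)))
      + (1 / 4 : ℝ) • (K y u (K y v w) - K y v (K y u w)) := by
  have e : A = fun z => B z + (1 / 2 : ℝ) • K z := by
    funext z; ext u v; exact hA z u v
  have hd : fderiv ℝ A y = fderiv ℝ B y + (1 / 2 : ℝ) • fderiv ℝ K y := by
    have hK' : DifferentiableAt ℝ (fun z => (1 / 2 : ℝ) • K z) y := hK.const_smul (1 / 2 : ℝ)
    rw [e, fderiv_fun_add hB hK', fderiv_fun_const_smul hK]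
  simp only [curvMap_apply, hA, hd, add_apply, smul_apply, map_add, map_smul]
  module

end Connection

/-! ### The Bismut connection: parallel `g` and `J`, curvature, and `dT` -/

section Bismut

variable {E : Type*} [NormedAddCommGroup E] [NormedSpace ℝ E] [FiniteDimensional ℝ E]

namespace IsHermitianOn

variable {G : E → E →L[ℝ] E →L[ℝ] ℝ} {J : E → E →L[ℝ] E} {U : Set E}

theorem fderiv_kahlerMap_nablaJ (h : IsHermitianOn G J U) {z : E} (hz : z ∈ U) (a b c : E) :
    fderiv ℝ (kahlerMap G J) z a b c = G z b (nablaJ G J z a c)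
      - G z (J z (christoffel G z a b)) c + G z b (J z (christoffel G z a c)) := by
  rw [h.fderiv_kahler hz, h.christoffel_metric hz, (h.nablaJ_spec hz).inner_J_left, nablaJ_apply]
  simp
  ring

/-- The exterior derivative may be computed with any torsion-free connection. With `∇^g`, which
preserves `g`, only the derivative of `J` contributes to that of `Ω`. -/
theorem dcMap_nablaJ (h : IsHermitianOn G J U) {z : E} (hz : z ∈ U) (u v w : E) :
    dcMap G J z u v w = -(G z (J z v) (nablaJ G J z (J z u) (J z w))
      - G z (J z u) (nablaJ G J z (J z v) (J z w))
      + G z (J z u) (nablaJ G J z (J z w) (J z v))) := by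
  have hP := h.nablaJ_spec hz
  have hk := h.fderiv_kahlerMap_nablaJ hz
  have hd : ∀ a b c, dKahlerMap G J z a b c = G z b (nablaJ G J z a c)
      - G z a (nablaJ G J z b c) + G z a (nablaJ G J z c b) := by
    intro a b c
    rw [dKahlerMap_apply, hk, hk, hk, h.christoffel_symm hz b a, h.christoffel_symm hz c a,
      h.christoffel_symm hz c b]
    simp only [hP.inner_J_left]
    have h1 := h.symm z hz (christoffel G z a c) (J z b)
    have h2 := h.symm z hz (christoffel G z b c) (J z a)
    have h3 := hP.inner_J_left b (christoffel G z a c)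
    have h4 := hP.inner_J_left a (christoffel G z b c)
    linarith
  rw [dcMap_apply, hd]

theorem dcMap_skew₁ (h : IsHermitianOn G J U) {z : E} (hz : z ∈ U) (u v w : E) :
    dcMap G J z u v w = - dcMap G J z v u w :=
  (h.nablaJ_spec hz).form_skew₁ (h.dcMap_nablaJ hz) u v w

theorem dcMap_skew₂ (h : IsHermitianOn G J U) {z : E} (hz : z ∈ U) (u v w : E) :
    dcMap G J z u v w = - dcMap G J z u w v :=
  (h.nablaJ_spec hz).form_skew₂ (h.dcMap_nablaJ hz) u v w

theorem dcMap_type (h : IsHermitianOn G J U) {z : E} (hz : z ∈ U) (u v w : E) :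
    dcMap G J z u v w = dcMap G J z (J z u) (J z v) w + dcMap G J z (J z u) v (J z w)
      + dcMap G J z u (J z v) (J z w) :=
  (h.nablaJ_spec hz).type_condition (h.dcMap_nablaJ hz) u v w

theorem dcMap_apply_J (h : IsHermitianOn G J U) {z : E} (hz : z ∈ U) (u v w : E) :
    dcMap G J z u (J z w) v + dcMap G J z u w (J z v) = - 2 * G z v (nablaJ G J z u w) :=
  (h.nablaJ_spec hz).sum_apply_J (h.dcMap_nablaJ hz) u v w

theorem torsionMap_skew (h : IsHermitianOn G J U) {z : E} (hz : z ∈ U) (u v : E) :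
    torsionMap G J z u v = - torsionMap G J z v u := by
  refine eq_of_inner_eq (h.pos z hz) fun w => ?_
  rw [map_neg, neg_apply, h.inner_torsionMap hz, h.inner_torsionMap hz, h.dcMap_skew₁ hz]

theorem bismut_metric (h : IsHermitianOn G J U) {z : E} (hz : z ∈ U) (u v w : E) :
    fderiv ℝ G z u v w = G z (bismutMap G J z u v) w + G z v (bismutMap G J z u w) := by
  rw [h.christoffel_metric hz, bismutMap_apply, bismutMap_apply]
  simp only [map_add, map_smul, add_apply, smul_apply]
  rw [h.inner_torsionMap hz, h.symm z hz v (torsionMap G J z u w), h.inner_torsionMap hz,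
    h.dcMap_skew₂ hz u v w]
  simp
  ring

/-- This is `∇J = 0`: by `dcMap_apply_J`, the commutator of `½T(u,·)` with `J` is exactly `-∇^g_u
J`. -/
theorem bismut_J (h : IsHermitianOn G J U) {z : E} (hz : z ∈ U) (u v : E) :
    fderiv ℝ J z u v = J z (bismutMap G J z u v) - bismutMap G J z u (J z v) := by
  refine eq_of_inner_eq (h.pos z hz) fun w => ?_
  have h1 := h.dcMap_apply_J hz u w v
  have h2 := (h.nablaJ_spec hz).inner_J_left (torsionMap G J z u v) w
  rw [h.inner_torsionMap hz] at h2
  rw [h.symm z hz w, nablaJ_apply] at h1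
  simp only [bismutMap_apply, map_add, map_sub, map_smul, add_apply, sub_apply, smul_apply,
    h.inner_torsionMap hz, h2] at h1 ⊢
  simp only [smul_eq_mul]
  linarith

/-- This and the next lemmas identify, on `U`, the function-valued definitions of the statement with
smooth multilinear maps. -/
theorem leviCivita_eq (h : IsHermitianOn G J U) {z : E} (hz : z ∈ U) (u v : E) :
    leviCivita G z u v = christoffel G z u v :=
  raise_eq_sharp (h.pos z hz) (lcForm G z u v)

theorem dcKahler_eq (h : IsHermitianOn G J U) {z : E} (hz : z ∈ U) (v : Fin 3 → E) :
    dcKahler G J z v = dcMap G J z (v 0) (v 1) (v 2) :=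
  congrArg Neg.neg (extD_two (h.diff_of_smooth h.smooth_kahler hz) fun i => J z (v i))

theorem bismut_eq (h : IsHermitianOn G J U) {z : E} (hz : z ∈ U) (u v : E) :
    bismut G J z u v = bismutMap G J z u v := by
  rw [bismut, h.leviCivita_eq hz, bismutMap_apply]
  simp only [h.dcKahler_eq hz]
  exact congrArg (fun x => christoffel G z u v + (1 / 2 : ℝ) • x)
    (raise_eq_sharp (h.pos z hz) (dcMap G J z u v))

theorem torsion_bismut (h : IsHermitianOn G J U) {z : E} (hz : z ∈ U) (u v : E) :
    torsion (bismut G J) z u v = torsionMap G J z u v := by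
  rw [torsion_eq, h.bismut_eq hz, h.bismut_eq hz, bismutMap_apply, bismutMap_apply,
    h.christoffel_symm hz u v, h.torsionMap_skew hz v u]
  module

theorem torsionForm_eq (h : IsHermitianOn G J U) {z : E} (hz : z ∈ U) (v : Fin 3 → E) :
    torsionForm G J z v = dcMap G J z (v 0) (v 1) (v 2) := by
  rw [torsionForm, h.torsion_bismut hz, h.inner_torsionMap hz]

theorem curvature_leviCivita (h : IsHermitianOn G J U) {z : E} (hz : z ∈ U) (u v w : E) :
    curvature (leviCivita G) z u v w = curvMap (christoffel G) z u v w :=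
  curvature_eq_curvMap ((h.eventually hz).mono fun _ hy => h.leviCivita_eq hy)
    (h.diff_of_smooth h.smooth_christoffel hz) u v w

theorem curvature_bismut (h : IsHermitianOn G J U) {z : E} (hz : z ∈ U) (u v w : E) :
    curvature (bismut G J) z u v w = curvMap (bismutMap G J) z u v w :=
  curvature_eq_curvMap ((h.eventually hz).mono fun _ hy => h.bismut_eq hy)
    (h.diff_of_smooth h.smooth_bismut hz) u v w

theorem curvMap_bismut_J (h : IsHermitianOn G J U) {z : E} (hz : z ∈ U) (u v w : E) :
    curvMap (bismutMap G J) z u v (J z w) = J z (curvMap (bismutMap G J) z u v w) :=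
  curvMap_J (h.smooth_J.contDiffAt (h.isOpen.mem_nhds hz))
    (h.diff_of_smooth h.smooth_bismut hz)
    ((h.eventually hz).mono fun _ hy => h.bismut_J hy) u v w

theorem curvMap_bismut_metric (h : IsHermitianOn G J U) {z : E} (hz : z ∈ U) (u v w x : E) :
    G z (curvMap (bismutMap G J) z u v w) x = - G z w (curvMap (bismutMap G J) z u v x) :=
  curvMap_metric (h.smooth_G.contDiffAt (h.isOpen.mem_nhds hz))
    (h.diff_of_smooth h.smooth_bismut hz)
    ((h.eventually hz).mono fun _ hy => h.bismut_metric hy) u v w x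

theorem curvMap_christoffel_metric (h : IsHermitianOn G J U) {z : E} (hz : z ∈ U)
    (u v w x : E) :
    G z (curvMap (christoffel G) z u v w) x = - G z w (curvMap (christoffel G) z u v x) :=
  curvMap_metric (h.smooth_G.contDiffAt (h.isOpen.mem_nhds hz))
    (h.diff_of_smooth h.smooth_christoffel hz)
    ((h.eventually hz).mono fun _ hy => h.christoffel_metric hy) u v w x

/-- The cyclic identity over the last three arguments of the Riemann tensor. -/
theorem curvMap_christoffel_cyclic (h : IsHermitianOn G J U) {z : E} (hz : z ∈ U)
    (u v w x : E) :
    G z (curvMap (christoffel G) z u v w) x + G z (curvMap (christoffel G) z u w x) v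
      + G z (curvMap (christoffel G) z u x v) w = 0 := by
  have hm : ∀ a b c d, G z (curvMap (christoffel G) z a b c) d
      = - G z (curvMap (christoffel G) z a b d) c := fun a b c d => by
    rw [h.curvMap_christoffel_metric hz, h.symm z hz]
  have hs : ∀ a b c d, G z (curvMap (christoffel G) z a b c) d
      = - G z (curvMap (christoffel G) z b a c) d := fun a b c d => by
    rw [curvMap_skew]; simp
  have hb : ∀ a b c d, G z (curvMap (christoffel G) z a b c) d
      + G z (curvMap (christoffel G) z b c a) d + G z (curvMap (christoffel G) z c a b) d = 0 := by
    intro a b c d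
    have := congrArg (fun t => G z t d) (curvMap_bianchi
      (h.diff_of_smooth h.smooth_christoffel hz)
      ((h.eventually hz).mono fun _ hy => h.christoffel_symm hy) a b c)
    simpa using this
  -- Pair symmetry of the Riemann tensor, from four Bianchi identities and skewness in each pair. It
  -- transfers the cyclic sum to the first three arguments.
  have hp : ∀ a b c d, G z (curvMap (christoffel G) z a b c) d
      = G z (curvMap (christoffel G) z c d a) b := by
    intro a b c d
    linarith [hb a b c d, hb b c d a, hb c d a b, hb d a b c, hm a b c d, hm b c a d,
      hm c a b d, hm b c d a, hm c d b a, hm d b c a, hm c d a b, hm d a c b, hm a c d b,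
      hm d a b c, hm a b d c, hm b d a c, hs a b c d, hs b c d a, hs c a b d, hs d b c a,
      hs c d a b, hs d a b c, hs a c d b, hs b d a c]
  rw [hp u v, hp u w, hp u x]
  linarith [hb w x v u, hm w x u v, hm x v u w, hm v w u x]

theorem covMap_christoffel_eq (h : IsHermitianOn G J U) {z : E} (hz : z ∈ U) (u v w x : E) :
    covMap (christoffel G) (dcMap G J) z u v w x =
      G z (fderiv ℝ (torsionMap G J) z u v w + christoffel G z u (torsionMap G J z v w)
        - torsionMap G J z (christoffel G z u v) w
        - torsionMap G J z v (christoffel G z u w)) x := by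
  have hK := h.diff_of_smooth h.smooth_torsion hz
  have hG := h.diff_G hz
  have hKc : DifferentiableAt ℝ (fun y => torsionMap G J y v w) z :=
    (hK.clm_apply (differentiableAt_const v)).clm_apply (differentiableAt_const w)
  have e : (fun y => dcMap G J y v w x) =ᶠ[𝓝 z] fun y => G y (torsionMap G J y v w) x := by
    filter_upwards [h.eventually hz] with y hy using (h.inner_torsionMap hy v w x).symm
  have hd : fderiv ℝ (dcMap G J) z u v w x = fderiv ℝ G z u (torsionMap G J z v w) x
      + G z (fderiv ℝ (torsionMap G J) z u v w) x := by
    rw [← fderiv_apply_const₃ (h.diff_of_smooth h.smooth_dc hz), e.fderiv_eq,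
      fderiv_apply_const (hG.clm_apply hKc), fderiv_clm_apply hG hKc]
    simp [fderiv_apply_const₂ hK]
    ring
  rw [covMap_apply, hd, h.christoffel_metric hz]
  simp only [map_add, map_sub, add_apply, sub_apply, h.inner_torsionMap hz]
  ring

/-- The coefficient derivatives in `curvMap_add` become `∇^g T`: the extra terms `T(Γ(u,v), w)`
cancel because `Γ` is symmetric. Skewness of `T(u,·)` brings the commutator into the form of
products `g(T,T)`. -/
theorem curvMap_bismut_eq (h : IsHermitianOn G J U) {z : E} (hz : z ∈ U) (u v w x : E) :
    G z (curvMap (bismutMap G J) z u v w) x = G z (curvMap (christoffel G) z u v w) x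
      + 1 / 2 * (covMap (christoffel G) (dcMap G J) z u v w x
        - covMap (christoffel G) (dcMap G J) z v u w x)
      + 1 / 4 * (G z (torsionMap G J z v x) (torsionMap G J z u w)
        - G z (torsionMap G J z u x) (torsionMap G J z v w)) := by
  have hq : ∀ a b, G z (torsionMap G J z a b) x = - G z (torsionMap G J z a x) b := by
    intro a b
    rw [h.inner_torsionMap hz, h.inner_torsionMap hz, h.dcMap_skew₂ hz]
  rw [curvMap_add (h.diff_of_smooth h.smooth_christoffel hz)
    (h.diff_of_smooth h.smooth_torsion hz) (bismutMap_apply G J), h.covMap_christoffel_eq hz,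
    h.covMap_christoffel_eq hz]
  simp only [map_add, map_sub, map_smul, add_apply, sub_apply, smul_apply, smul_eq_mul,
    hq u (torsionMap G J z v w), hq v (torsionMap G J z u w),
    h.christoffel_symm hz u v]
  ring

/-- The difference `½T` of the connections acts on each of the three slots of `T`; total skewness
writes each result as a product `g(T,T)`. -/
theorem covMap_bismut_eq (h : IsHermitianOn G J U) {z : E} (hz : z ∈ U) (u v w x : E) :
    covMap (christoffel G) (dcMap G J) z u v w x = covMap (bismutMap G J) (dcMap G J) z u v w x
      + 1 / 2 * (G z (torsionMap G J z u v) (torsionMap G J z w x)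
        + G z (torsionMap G J z v w) (torsionMap G J z u x)
        + G z (torsionMap G J z w u) (torsionMap G J z v x)) := by
  have h1 : ∀ a b c, dcMap G J z a b c = G z (torsionMap G J z b c) a := by
    intro a b c
    rw [h.inner_torsionMap hz, h.dcMap_skew₁ hz, h.dcMap_skew₂ hz]; ring
  have e1 : dcMap G J z (torsionMap G J z u v) w x
      = G z (torsionMap G J z u v) (torsionMap G J z w x) := by
    rw [h1, h.symm z hz]
  have e2 : dcMap G J z v (torsionMap G J z u w) x
      = G z (torsionMap G J z w u) (torsionMap G J z v x) := by
    rw [h.dcMap_skew₂ hz, ← h.inner_torsionMap hz v x, h.symm z hz, h.torsionMap_skew hz u w]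
    simp
  have e3 : dcMap G J z v w (torsionMap G J z u x)
      = G z (torsionMap G J z v w) (torsionMap G J z u x) := (h.inner_torsionMap hz _ _ _).symm
  rw [covMap_apply, covMap_apply]
  simp only [bismutMap_apply, map_add, map_smul, add_apply, smul_apply, e1, e2, e3, smul_eq_mul]
  ring

theorem extD_torsionForm (h : IsHermitianOn G J U) {z : E} (hz : z ∈ U) (u v w x : E) :
    extD (torsionForm G J) z ![u, v, w, x] =
      covMap (christoffel G) (dcMap G J) z u v w x - covMap (christoffel G) (dcMap G J) z v u w x
      + covMap (christoffel G) (dcMap G J) z w u v x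
      - covMap (christoffel G) (dcMap G J) z x u v w := by
  have e : ∀ v : Fin 3 → E, (fun y => torsionForm G J y v) =ᶠ[𝓝 z]
      fun y => dcMap G J y (v 0) (v 1) (v 2) := by
    intro v
    filter_upwards [h.eventually hz] with y hy using h.torsionForm_eq hy v
  have e1 : extD (torsionForm G J) z ![u, v, w, x] =
      extD (fun y (v : Fin 3 → E) => dcMap G J y (v 0) (v 1) (v 2)) z ![u, v, w, x] := by
    unfold extD
    exact Finset.sum_congr rfl fun i _ => by rw [(e _).fderiv_eq]
  rw [e1, extD_three (h.diff_of_smooth h.smooth_dc hz)]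
  simp only [covMap_apply, h.christoffel_symm hz v u, h.christoffel_symm hz w u,
    h.christoffel_symm hz x u, h.christoffel_symm hz w v, h.christoffel_symm hz x v,
    h.christoffel_symm hz x w]
  -- With the Christoffel vectors as free symbols, the goal is linear in values of the 3-form, and
  -- total skewness makes the correction terms cancel in pairs.
  generalize christoffel G z u v = a
  generalize christoffel G z u w = b
  generalize christoffel G z u x = c
  generalize christoffel G z v w = d
  generalize christoffel G z v x = f
  generalize christoffel G z w x = k
  linarith [h.dcMap_skew₁ hz u d x, h.dcMap_skew₂ hz u w f, h.dcMap_skew₁ hz v b x,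
    h.dcMap_skew₂ hz v w c, h.dcMap_skew₁ hz u a x, h.dcMap_skew₂ hz u v k, h.dcMap_skew₂ hz u k v,
    h.dcMap_skew₂ hz d u x, h.dcMap_skew₂ hz b v x, h.dcMap_skew₁ hz c v w, h.dcMap_skew₁ hz f u w,
    h.dcMap_skew₂ hz u f w, h.dcMap_skew₂ hz v c w]

end IsHermitianOn
end Bismut

/-! ### Contractions as sums over an orthonormal basis -/

section Traces

variable {E : Type*} [NormedAddCommGroup E] [NormedSpace ℝ E]

/-- Evaluation of bilinear forms at a pair of vectors. -/
def evalPair (v w : E) : (E →L[ℝ] E →L[ℝ] ℝ) →L[ℝ] ℝ :=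
  (ContinuousLinearMap.apply ℝ ℝ w).comp (ContinuousLinearMap.apply ℝ (E →L[ℝ] ℝ) v)

@[simp] theorem evalPair_apply (v w : E) (B : E →L[ℝ] E →L[ℝ] ℝ) : evalPair v w B = B v w := rfl

/-- The exterior derivative of a trilinear form, in its last two arguments, in terms of a
torsion free covariant derivative `N`. -/
def altLast (N : E →L[ℝ] E →L[ℝ] E →L[ℝ] E →L[ℝ] ℝ) (u v : E) : E →L[ℝ] E →L[ℝ] ℝ :=
  N u v - N v u + (N.flip u).flip v - ((N.flip u).flip v).flip

theorem covMap_skew₁ {B : E → E →L[ℝ] E →L[ℝ] E} {τ : E → E →L[ℝ] E →L[ℝ] E →L[ℝ] ℝ} {y : E}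
    (hτ : DifferentiableAt ℝ τ y) (h : ∀ᶠ z in 𝓝 y, ∀ a b c, τ z a b c = - τ z b a c)
    (u a b c : E) : covMap B τ y u a b c = - covMap B τ y u b a c := by
  have e : (fun z => τ z a b c) =ᶠ[𝓝 y] fun z => - τ z b a c := by
    filter_upwards [h] with z hz using hz a b c
  have hd : fderiv ℝ τ y u a b c = - fderiv ℝ τ y u b a c := by
    rw [← fderiv_apply_const₃ hτ, e.fderiv_eq, fderiv_fun_neg, neg_apply, fderiv_apply_const₃ hτ]
  have hy := h.self_of_nhds
  rw [covMap_apply, covMap_apply, hd, hy (B y u a), hy a, hy a b]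
  ring

theorem covMap_skew₂ {B : E → E →L[ℝ] E →L[ℝ] E} {τ : E → E →L[ℝ] E →L[ℝ] E →L[ℝ] ℝ} {y : E}
    (hτ : DifferentiableAt ℝ τ y) (h : ∀ᶠ z in 𝓝 y, ∀ a b c, τ z a b c = - τ z a c b)
    (u a b c : E) : covMap B τ y u a b c = - covMap B τ y u a c b := by
  have e : (fun z => τ z a b c) =ᶠ[𝓝 y] fun z => - τ z a c b := by
    filter_upwards [h] with z hz using hz a b c
  have hd : fderiv ℝ τ y u a b c = - fderiv ℝ τ y u a c b := by
    rw [← fderiv_apply_const₃ hτ, e.fderiv_eq, fderiv_fun_neg, neg_apply, fderiv_apply_const₃ hτ]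
  have hy := h.self_of_nhds
  rw [covMap_apply, covMap_apply, hd, hy (B y u a), hy a (B y u b), hy a b]
  ring

variable [FiniteDimensional ℝ E]

namespace IsHermitianOn

variable {G : E → E →L[ℝ] E →L[ℝ] ℝ} {J : E → E →L[ℝ] E} {U : Set E}

theorem cov_skew₁ (h : IsHermitianOn G J U) {z : E} (hz : z ∈ U) (B : E → E →L[ℝ] E →L[ℝ] E)
    (u a b c : E) : covMap B (dcMap G J) z u a b c = - covMap B (dcMap G J) z u b a c :=
  covMap_skew₁ (h.diff_of_smooth h.smooth_dc hz)
    ((h.eventually hz).mono fun _ hy => h.dcMap_skew₁ hy) u a b c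

theorem cov_skew₂ (h : IsHermitianOn G J U) {z : E} (hz : z ∈ U) (B : E → E →L[ℝ] E →L[ℝ] E)
    (u a b c : E) : covMap B (dcMap G J) z u a b c = - covMap B (dcMap G J) z u a c b :=
  covMap_skew₂ (h.diff_of_smooth h.smooth_dc hz)
    ((h.eventually hz).mono fun _ hy => h.dcMap_skew₂ hy) u a b c

/-- The Lee form is a trace of the torsion. -/
theorem leeForm_eq_trace (h : IsHermitianOn G J U) {z : E} (hz : z ∈ U) (v : Fin 1 → E) :
    leeForm G J z v =
      -(1 / 2) * metricTrace (G z) (fun a b => dcMap G J z (J z (v 0)) a (J z b)) := by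
  set w := J z (v 0) with hw
  -- `(∇^g_a Ω)(b,w) = g(b, (∇^g_a J) w)`, which `dcMap_apply_J` expresses through `T`. The first
  -- resulting term is skew in `a, b`, so its trace vanishes (`h0`).
  have hcov : ∀ a b, covTensor (leviCivita G) (kahlerForm G J) z a ![b, w]
      = -(1 / 2) * dcMap G J z a (J z w) b + 1 / 2 * dcMap G J z w a (J z b) := by
    intro a b
    have e : (fun y => kahlerForm G J y ![b, w]) = fun y => kahlerMap G J y b w := rfl
    have h1 := h.dcMap_apply_J hz a b w
    have h2 := (h.nablaJ_spec hz).inner_J_left (christoffel G z a b) w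
    rw [covTensor, e, fderiv_apply_const₂ (h.diff_of_smooth h.smooth_kahler hz),
      h.fderiv_kahlerMap_nablaJ hz, h.dcMap_skew₁ hz w a]
    simp [h.leviCivita_eq hz, kahlerForm]
    linarith
  have h0 : metricTrace (G z) (fun a b => dcMap G J z a (J z w) b) = 0 :=
    metricTrace_eq_zero_of_skew (h.pos z hz) (h.symm z hz) ((dcMap G J z).flip (J z w))
      fun u v => by
        simp only [ContinuousLinearMap.flip_apply]
        rw [h.dcMap_skew₁ hz, h.dcMap_skew₂ hz, h.dcMap_skew₁ hz, neg_neg]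
  have h1 : leeForm G J z v = - metricTrace (G z)
      (fun a b => covTensor (leviCivita G) (kahlerForm G J) z a ![b, w]) := rfl
  rw [h1]
  simp only [hcov]
  rw [metricTrace_add, metricTrace_const_mul, metricTrace_const_mul, h0]
  ring

/-- The Bismut derivative of the Lee form is a trace of the derivative of the torsion. -/
theorem covTensor_leeForm (h : IsHermitianOn G J U) {z : E} (hz : z ∈ U) (X Y : E) :
    covTensor (bismut G J) (leeForm G J) z X ![Y] = -(1 / 2) * metricTrace (G z)
      (fun a b => covMap (bismutMap G J) (dcMap G J) z X (J z Y) a (J z b)) := by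
  let B : E → E →L[ℝ] E →L[ℝ] ℝ := fun y => (precomp (J y)).comp (dcMap G J y (J y Y))
  have hτ := h.diff_of_smooth h.smooth_dc hz
  have hJ := h.diff_J hz
  have hJc : ∀ v, DifferentiableAt ℝ (fun y => J y v) z := fun v =>
    hJ.clm_apply (differentiableAt_const v)
  have hBs : ContDiffOn ℝ ∞ B U := contDiffOn_clm_apply₂ fun a b =>
    ((h.smooth_dc.clm_apply (h.smooth_J.clm_apply contDiffOn_const)).clm_apply
      contDiffOn_const).clm_apply (h.smooth_J.clm_apply contDiffOn_const)
  have hB : DifferentiableAt ℝ B z := h.diff_of_smooth hBs hz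
  have hdB : ∀ a b, fderiv ℝ B z X a b = fderiv ℝ (dcMap G J) z X (J z Y) a (J z b)
      + dcMap G J z (fderiv ℝ J z X Y) a (J z b)
      + dcMap G J z (J z Y) a (fderiv ℝ J z X b) := by
    intro a b
    rw [← fderiv_apply_const₂ hB]
    have e : (fun y => B y a b) = fun y => dcMap G J y (J y Y) a (J y b) := rfl
    rw [e, fderiv_clm_apply ((hτ.clm_apply (hJc Y)).clm_apply (differentiableAt_const a)) (hJc b),
      fderiv_clm_apply (hτ.clm_apply (hJc Y)) (differentiableAt_const a),
      fderiv_clm_apply hτ (hJc Y)]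
    simp [fderiv_apply_const hJ]
    ring
  have e : (fun y => leeForm G J y ![Y]) =ᶠ[𝓝 z]
      fun y => -(1 / 2) * metricTrace (G y) (fun a b => B y a b) := by
    filter_upwards [h.eventually hz] with y hy
    rw [h.leeForm_eq_trace hy]
    rfl
  -- Metricity of the Bismut connection supplies the endomorphism `N = bismutMap G J z X`.
  have ht := fderiv_metricTrace (h.diff_G hz) ((h.eventually hz).mono fun y hy => h.pos y hy)
    (fun v w => h.bismut_metric hz X v w) hB
  -- By `∇J = 0`, the derivatives of both `J`s turn into connection terms. The last trace is the one
  -- that the connection term of `∇_X θ` cancels.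
  have hm : metricTrace (G z) (fun a b => fderiv ℝ B z X a b - B z (bismutMap G J z X a) b
        - B z a (bismutMap G J z X b)) =
      metricTrace (G z)
        (fun a b => covMap (bismutMap G J) (dcMap G J) z X (J z Y) a (J z b))
      + metricTrace (G z) (fun a b => dcMap G J z (J z (bismutMap G J z X Y)) a (J z b)) := by
    rw [← metricTrace_add]
    congr 1
    funext a b
    have hBz : ∀ a b, B z a b = dcMap G J z (J z Y) a (J z b) := fun _ _ => rfl
    rw [hdB, hBz, hBz, covMap_apply, h.bismut_J hz X Y, h.bismut_J hz X b]
    simp only [map_sub, sub_apply]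
    ring
  have hc : fderiv ℝ (fun y => -(1 / 2) * metricTrace (G y) (fun a b => B y a b)) z =
      (-(1 / 2) : ℝ) • fderiv ℝ (fun y => metricTrace (G y) (fun a b => B y a b)) z :=
    congrFun (fderiv_const_smul_field (f := fun y => metricTrace (G y) (fun a b => B y a b))
      (-(1 / 2) : ℝ)) z
  rw [covTensor, e.fderiv_eq, hc, smul_apply, ht, hm]
  simp [h.bismut_eq hz, h.leeForm_eq_trace hz]
  ring

variable {ι : Type*} [Fintype ι] [DecidableEq ι]

theorem ricci_leviCivita_eq_sum (h : IsHermitianOn G J U) {z : E} (hz : z ∈ U)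
    (e : Module.Basis ι ℝ E) (he : ∀ i j, G z (e i) (e j) = if i = j then 1 else 0) (X Y : E) :
    ricci G (leviCivita G) z X Y =
      ∑ i, G z (curvMap (christoffel G) z (e i) X Y) (e i) := by
  simp only [ricci, h.curvature_leviCivita hz]
  exact metricTrace_eq_sum_clm (h.pos z hz) e he
    ((G z).comp (((curvMap (christoffel G) z).flip X).flip Y))

theorem ricci_bismut_eq_sum (h : IsHermitianOn G J U) {z : E} (hz : z ∈ U)
    (e : Module.Basis ι ℝ E) (he : ∀ i j, G z (e i) (e j) = if i = j then 1 else 0) (X Y : E) :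
    ricci G (bismut G J) z X Y =
      ∑ i, G z (curvMap (bismutMap G J) z (e i) X Y) (e i) := by
  simp only [ricci, h.curvature_bismut hz]
  exact metricTrace_eq_sum_clm (h.pos z hz) e he
    ((G z).comp (((curvMap (bismutMap G J) z).flip X).flip Y))

theorem ricciForm_bismut_eq_sum (h : IsHermitianOn G J U) {z : E} (hz : z ∈ U)
    (e : Module.Basis ι ℝ E) (he : ∀ i j, G z (e i) (e j) = if i = j then 1 else 0) (X Y : E) :
    ricciForm G J (bismut G J) z X Y =
      1 / 2 * ∑ i, G z (curvMap (bismutMap G J) z X Y (e i)) (J z (e i)) := by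
  simp only [ricciForm, h.curvature_bismut hz]
  exact congrArg (fun t : ℝ => 1 / 2 * t) (metricTrace_eq_sum_clm (h.pos z hz) e he
    ((precomp (J z)).comp ((G z).comp (curvMap (bismutMap G J) z X Y))))

theorem codiff_torsionForm_eq_sum (h : IsHermitianOn G J U) {z : E} (hz : z ∈ U)
    (e : Module.Basis ι ℝ E) (he : ∀ i j, G z (e i) (e j) = if i = j then 1 else 0) (X Y : E) :
    codiff G (torsionForm G J) z ![X, Y] =
      - ∑ i, covMap (christoffel G) (dcMap G J) z (e i) (e i) X Y := by
  have hc : ∀ a b, covTensor (leviCivita G) (torsionForm G J) z a (Fin.cons b ![X, Y]) =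
      covMap (christoffel G) (dcMap G J) z a b X Y := fun a b =>
    covTensor_three (h.leviCivita_eq hz) (h.diff_of_smooth h.smooth_dc hz)
      ((h.eventually hz).mono fun _ hy => h.torsionForm_eq hy) a b X Y
  simp only [codiff, hc]
  exact congrArg Neg.neg (metricTrace_eq_sum_clm (h.pos z hz) e he
    (post (evalPair X Y) (covMap (christoffel G) (dcMap G J) z)))

theorem lambdaOmega_eq_sum (h : IsHermitianOn G J U) {z : E} (hz : z ∈ U)
    (e : Module.Basis ι ℝ E) (he : ∀ i j, G z (e i) (e j) = if i = j then 1 else 0) (X Y : E) :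
    lambdaOmega G J z X Y = ∑ i, extD (torsionForm G J) z ![X, Y, e i, J z (e i)] := by
  simp only [lambdaOmega, h.extD_torsionForm hz]
  exact metricTrace_eq_sum_clm (h.pos z hz) e he
    ((precomp (J z)).comp (altLast (covMap (christoffel G) (dcMap G J) z) X Y))

theorem leeForm_eq_sum (h : IsHermitianOn G J U) {z : E} (hz : z ∈ U)
    (e : Module.Basis ι ℝ E) (he : ∀ i j, G z (e i) (e j) = if i = j then 1 else 0)
    (v : Fin 1 → E) :
    leeForm G J z v = -(1 / 2) * ∑ i, dcMap G J z (J z (v 0)) (e i) (J z (e i)) := by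
  rw [h.leeForm_eq_trace hz]
  exact congrArg (fun t : ℝ => -(1 / 2) * t) (metricTrace_eq_sum_clm (h.pos z hz) e he
    ((precomp (J z)).comp (dcMap G J z (J z (v 0)))))

theorem covTensor_leeForm_eq_sum (h : IsHermitianOn G J U) {z : E} (hz : z ∈ U)
    (e : Module.Basis ι ℝ E) (he : ∀ i j, G z (e i) (e j) = if i = j then 1 else 0) (X Y : E) :
    covTensor (bismut G J) (leeForm G J) z X ![Y] =
      -(1 / 2) * ∑ i, covMap (bismutMap G J) (dcMap G J) z X (J z Y) (e i) (J z (e i)) := by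
  rw [h.covTensor_leeForm hz]
  exact congrArg (fun t : ℝ => -(1 / 2) * t) (metricTrace_eq_sum_clm (h.pos z hz) e he
    ((precomp (J z)).comp (covMap (bismutMap G J) (dcMap G J) z X (J z Y))))

/-- The trace vector `∑ T(e_i, J e_i)` of the torsion. -/
def torsionTrace (G : E → E →L[ℝ] E →L[ℝ] ℝ) (J : E → E →L[ℝ] E) (z : E)
    (e : Module.Basis ι ℝ E) : E :=
  ∑ i, torsionMap G J z (e i) (J z (e i))

theorem leeForm_eq_inner (h : IsHermitianOn G J U) {z : E} (hz : z ∈ U)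
    (e : Module.Basis ι ℝ E) (he : ∀ i j, G z (e i) (e j) = if i = j then 1 else 0)
    (v : Fin 1 → E) :
    leeForm G J z v = -(1 / 2) * G z (torsionTrace G J z e) (J z (v 0)) := by
  rw [h.leeForm_eq_sum hz e he, torsionTrace, map_sum, sum_apply]
  congr 1
  refine Finset.sum_congr rfl fun i _ => ?_
  rw [h.inner_torsionMap hz, h.dcMap_skew₁ hz, h.dcMap_skew₂ hz, neg_neg]

/-- The derivatives `∇^g θ` and `∇θ` differ by `½ θ(T(a,b))`, which is skew and has no trace, so
`d†θ` may be computed with the Bismut connection. -/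
theorem codiff_leeForm_eq_sum (h : IsHermitianOn G J U) {z : E} (hz : z ∈ U)
    (e : Module.Basis ι ℝ E) (he : ∀ i j, G z (e i) (e j) = if i = j then 1 else 0) :
    codiff G (leeForm G J) z ![] = 1 / 2 * ∑ j, ∑ i,
      covMap (bismutMap G J) (dcMap G J) z (e j) (J z (e j)) (e i) (J z (e i)) := by
  -- Half the Lee form: `θ = -½ g(t, J·)` with `t` the trace vector.
  let Θ : E →L[ℝ] ℝ := (-(1 / 4) : ℝ) • (G z (torsionTrace G J z e)).comp (J z)
  let Q : E →L[ℝ] E →L[ℝ] ℝ := (-(1 / 2) : ℝ) • ∑ i, (precomp (J z)).comp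
    (post (evalPair (e i) (J z (e i))) (covMap (bismutMap G J) (dcMap G J) z))
  have hc : ∀ a b, covTensor (leviCivita G) (leeForm G J) z a (Fin.cons b ![]) =
      (Q + post Θ (torsionMap G J z)) a b := by
    intro a b
    have h1 := h.covTensor_leeForm_eq_sum hz e he a b
    have h2 : covTensor (leviCivita G) (leeForm G J) z a ![b] =
        covTensor (bismut G J) (leeForm G J) z a ![b]
          - 1 / 4 * G z (torsionTrace G J z e) (J z (torsionMap G J z a b)) := by
      simp only [covTensor, Finset.univ_unique, Finset.sum_singleton,
        h.leeForm_eq_inner hz e he]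
      simp [h.leviCivita_eq hz, h.bismut_eq hz, bismutMap_apply]
      ring
    refine h2.trans ?_
    rw [h1]
    simp [Q, Θ, sum_apply]
    ring
  have hK : ∑ i, Θ (torsionMap G J z (e i) (e i)) = 0 := by
    refine Finset.sum_eq_zero fun i _ => ?_
    have := congrArg Θ (h.torsionMap_skew hz (e i) (e i))
    rw [map_neg] at this
    linarith
  simp only [codiff, hc]
  rw [metricTrace_eq_sum_clm (h.pos z hz) e he]
  simp only [add_apply, post_apply, Finset.sum_add_distrib, hK]
  simp [Q, sum_apply, ← Finset.mul_sum]

/-- Since `θ = -½ g(t, J·)` and `J` is an isometry, `|θ|² = ¼|t|²`. -/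
theorem normSq₁_leeForm_eq (h : IsHermitianOn G J U) {z : E} (hz : z ∈ U)
    (e : Module.Basis ι ℝ E) (he : ∀ i j, G z (e i) (e j) = if i = j then 1 else 0) :
    normSq₁ (G z) (leeForm G J z) =
      1 / 4 * G z (torsionTrace G J z e) (torsionTrace G J z e) := by
  let Θ : E →L[ℝ] ℝ := (-(1 / 2) : ℝ) • (G z (torsionTrace G J z e)).comp (J z)
  have hΘ : ∀ a, leeForm G J z ![a] = Θ a := fun a => h.leeForm_eq_inner hz e he ![a]
  simp only [normSq₁, hΘ]
  have h1 : metricTrace (G z) (fun a b => Θ a * Θ b) = ∑ i, Θ (e i) * Θ (e i) :=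
    metricTrace_eq_sum_clm (h.pos z hz) e he (Θ.smulRight Θ)
  have h2 := sum_isometry (h.pos z hz) (h.compat z hz) (h.J_sq z hz) e he
    ((G z (torsionTrace G J z e)).smulRight (G z (torsionTrace G J z e)))
  have h3 := inner_eq_sum e he (torsionTrace G J z e) (torsionTrace G J z e)
  simp only [ContinuousLinearMap.smulRight_apply, smul_apply, smul_eq_mul] at h2
  rw [h1, h3, ← h2, Finset.mul_sum]
  refine Finset.sum_congr rfl fun i _ => ?_
  simp [Θ]
  ring

theorem normSq₃_torsionForm_eq_sum (h : IsHermitianOn G J U) {z : E} (hz : z ∈ U)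
    (e : Module.Basis ι ℝ E) (he : ∀ i j, G z (e i) (e j) = if i = j then 1 else 0) :
    normSq₃ (G z) (torsionForm G J z) = ∑ i, ∑ j, ∑ k,
      dcMap G J z (e i) (e j) (e k) * dcMap G J z (e i) (e j) (e k) := by
  have hT : ∀ a b c, torsionForm G J z ![a, b, c] = dcMap G J z a b c := fun a b c =>
    h.torsionForm_eq hz ![a, b, c]
  simp only [normSq₃, hT]
  have h1 : ∀ a a' b b', metricTrace (G z) (fun c c' => dcMap G J z a b c * dcMap G J z a' b' c')
      = ∑ k, dcMap G J z a b (e k) * dcMap G J z a' b' (e k) := fun a a' b b' =>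
    metricTrace_eq_sum_clm (h.pos z hz) e he ((dcMap G J z a b).smulRight (dcMap G J z a' b'))
  have h2 : ∀ a a', metricTrace (G z)
      (fun b b' => ∑ k, dcMap G J z a b (e k) * dcMap G J z a' b' (e k))
      = ∑ j, ∑ k, dcMap G J z a (e j) (e k) * dcMap G J z a' (e j) (e k) := by
    intro a a'
    have := metricTrace_eq_sum_clm (h.pos z hz) e he
      (∑ k, ((dcMap G J z a).flip (e k)).smulRight ((dcMap G J z a').flip (e k)))
    simpa [sum_apply] using this
  have h3 := metricTrace_eq_sum_clm (h.pos z hz) e he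
    (∑ j, ∑ k, ((evalPair (e j) (e k)).comp (dcMap G J z)).smulRight
      ((evalPair (e j) (e k)).comp (dcMap G J z)))
  simp only [h1, h2]
  simpa [sum_apply] using h3

end IsHermitianOn
end Traces

/-! ### The cyclic identity and the three curvature formulas -/

section Identities

variable {E : Type*} [NormedAddCommGroup E] [NormedSpace ℝ E] [FiniteDimensional ℝ E]

namespace IsHermitianOn

variable {G : E → E →L[ℝ] E →L[ℝ] ℝ} {J : E → E →L[ℝ] E} {U : Set E}

/-- The cyclic identity over the last three arguments of the Bismut curvature. -/
theorem curvMap_bismut_cyclic (h : IsHermitianOn G J U) {z : E} (hz : z ∈ U) (u v w x : E) :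
    G z (curvMap (bismutMap G J) z u v w) x + G z (curvMap (bismutMap G J) z u w x) v
      + G z (curvMap (bismutMap G J) z u x v) w =
    1 / 2 * extD (torsionForm G J) z ![u, v, w, x]
      + covMap (bismutMap G J) (dcMap G J) z u v w x := by
  rw [h.curvMap_bismut_eq hz, h.curvMap_bismut_eq hz, h.curvMap_bismut_eq hz,
    h.extD_torsionForm hz]
  -- The Riemannian part vanishes. The derivative terms add up to `½ dT + ∇^g_u T`, and the
  -- commutator terms to `-½σ`, where `σ` is the sum of three products in `covMap_bismut_eq`;
  -- replacing `∇^g_u T` by `∇_u T` contributes `+½σ`.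
  have h0 := h.curvMap_christoffel_cyclic hz u v w x
  have h1 := h.covMap_bismut_eq hz u v w x
  have s := h.cov_skew₁ hz (christoffel G)
  have t := h.cov_skew₂ hz (christoffel G)
  have sk : ∀ a b c d, G z (torsionMap G J z a b) (torsionMap G J z c d)
      = - G z (torsionMap G J z b a) (torsionMap G J z c d) := fun a b c d => by
    rw [h.torsionMap_skew hz a b]; simp
  have sy := fun a b c d => h.symm z hz (torsionMap G J z a b) (torsionMap G J z c d)
  linarith [t u v x w, s u w v x, t u w x v, s u x w v, t v u w x, t w u x v, s x u v w,
    t x v u w, s w u v x, t u w v x, s u x v w, t u x w v, t x u w v, t x u v w,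
    t w u v x, t w v x u, t w u x v,
    sy v x u w, sy u x v w, sy w v u x, sy u v w x, sy x w u v, sy u w x v,
    sk w u v x, sk v w u x, sk x v u w, sk v x u w, sk w x u v, sk w u x v, sk v u w x,
    sk x w u v, sk v u x w, sk w v u x, sy v u w x, sy v u x w, sk u v x w,
    sy w x u v, sk w u v x, sy w u v x]

/-- The exterior derivative of the torsion through the Bismut connection. -/
theorem extD_torsionForm_bismut (h : IsHermitianOn G J U) {z : E} (hz : z ∈ U) (u v w x : E) :
    extD (torsionForm G J) z ![u, v, w, x] =
      covMap (bismutMap G J) (dcMap G J) z u v w x - covMap (bismutMap G J) (dcMap G J) z v u w x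
      + covMap (bismutMap G J) (dcMap G J) z w u v x
      - covMap (bismutMap G J) (dcMap G J) z x u v w
      + 2 * (G z (torsionMap G J z u v) (torsionMap G J z w x)
        + G z (torsionMap G J z v w) (torsionMap G J z u x)
        + G z (torsionMap G J z w u) (torsionMap G J z v x)) := by
  -- The quadratic expression is alternating in all four arguments, so the four signed copies of its
  -- half agree: the coefficient is `4 · ½ = 2`.
  rw [h.extD_torsionForm hz, h.covMap_bismut_eq hz, h.covMap_bismut_eq hz, h.covMap_bismut_eq hz,
    h.covMap_bismut_eq hz]
  have sk : ∀ a b c d, G z (torsionMap G J z a b) (torsionMap G J z c d)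
      = - G z (torsionMap G J z b a) (torsionMap G J z c d) := fun a b c d => by
    rw [h.torsionMap_skew hz a b]; simp
  have sy := fun a b c d => h.symm z hz (torsionMap G J z a b) (torsionMap G J z c d)
  linarith [sk v u w x, sk u w v x, sk w v u x, sk w u v x, sk x u v w, sy x u v w, sk v w x u,
    sy u v w x, sy u v x w, sk x w u v, sy x v u w, sk x v u w, sy v x w u, sk v x w u,
    sy v x u w, sy u v w x, sk u v w x, sy w x u v, sy u x v w, sk u x v w, sk u w x v,
    sy v w x u, sk x u v w, sy u x w v, sk v w u x, sy w u v x, sy w u x v, sy w v u x, sk v x u w]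

variable {ι : Type*} [Fintype ι] [DecidableEq ι]

/-- Contraction of `curvMap_bismut_eq` in its outer arguments: the derivative along `e_i` gives
`d†T`, while the derivative along `X` vanishes because `T(e_i, Y, e_i) = 0`. -/
theorem ricci_leviCivita_eq (h : IsHermitianOn G J U) {z : E} (hz : z ∈ U)
    (e : Module.Basis ι ℝ E) (he : ∀ i j, G z (e i) (e j) = if i = j then 1 else 0) (X Y : E) :
    ricci G (leviCivita G) z X Y = ricci G (bismut G J) z X Y
      + 1 / 2 * codiff G (torsionForm G J) z ![X, Y]
      + 1 / 4 * ∑ i, G z (torsion (bismut G J) z X (e i)) (torsion (bismut G J) z Y (e i)) := by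
  rw [h.ricci_leviCivita_eq_sum hz e he, h.ricci_bismut_eq_sum hz e he,
    h.codiff_torsionForm_eq_sum hz e he]
  simp only [h.torsion_bismut hz]
  rw [← Finset.sum_neg_distrib, Finset.mul_sum, Finset.mul_sum, ← Finset.sum_add_distrib,
    ← Finset.sum_add_distrib]
  refine Finset.sum_congr rfl fun i _ => ?_
  have h1 := h.curvMap_bismut_eq hz (e i) X Y (e i)
  have h2 : G z (torsionMap G J z (e i) (e i)) (torsionMap G J z X Y) = 0 := by
    have := h.dcMap_skew₁ hz (e i) (e i) (torsionMap G J z X Y)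
    rw [h.inner_torsionMap hz]
    linarith
  have h3 := h.cov_skew₂ hz (christoffel G) (e i) X Y (e i)
  have h4 := h.cov_skew₁ hz (christoffel G) (e i) X (e i) Y
  have h5 := h.cov_skew₁ hz (christoffel G) X (e i) Y (e i)
  have h6 := h.cov_skew₂ hz (christoffel G) X Y (e i) (e i)
  have h7 : G z (torsionMap G J z X (e i)) (torsionMap G J z (e i) Y)
      = - G z (torsionMap G J z X (e i)) (torsionMap G J z Y (e i)) := by
    rw [h.torsionMap_skew hz (e i) Y, map_neg]
  linarith

/-- Half of the cyclic identity at `(X, Y, e_i, Je_i)`, summed over `i`. The trace of `∇_X T` is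
`2(∇_X θ)(JY)`, since `J(JY) = -Y` reverses the sign in the trace formula for `∇θ`. -/
theorem ricciForm_bismut_eq (h : IsHermitianOn G J U) {z : E} (hz : z ∈ U)
    (e : Module.Basis ι ℝ E) (he : ∀ i j, G z (e i) (e j) = if i = j then 1 else 0) (X Y : E) :
    ricciForm G J (bismut G J) z X Y = ricci G (bismut G J) z X (J z Y)
      + covTensor (bismut G J) (leeForm G J) z X ![J z Y]
      + 1 / 4 * lambdaOmega G J z X Y := by
  have hP := h.nablaJ_spec hz
  have hr : ∀ v w, G z (curvMap (bismutMap G J) z X v Y) (J z w)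
      = G z (curvMap (bismutMap G J) z v X (J z Y)) w := by
    intro v w
    rw [h.curvMap_bismut_J hz, hP.inner_J_left, curvMap_skew]
    simp
  have h1 : ∑ i, G z (curvMap (bismutMap G J) z X (e i) (J z (e i))) Y
      = - ricci G (bismut G J) z X (J z Y) := by
    rw [h.ricci_bismut_eq_sum hz e he, ← Finset.sum_neg_distrib]
    refine Finset.sum_congr rfl fun i _ => ?_
    rw [h.curvMap_bismut_metric hz, h.symm z hz, hr]
  have h2 : ∑ i, G z (curvMap (bismutMap G J) z X (J z (e i)) Y) (e i)
      = - ricci G (bismut G J) z X (J z Y) := by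
    rw [h.ricci_bismut_eq_sum hz e he]
    refine (sum_isometry_left hP.pos hP.compat hP.J_sq e he
      ((G z).comp ((curvMap (bismutMap G J) z X).flip Y))).trans ?_
    exact congrArg Neg.neg (Finset.sum_congr rfl fun i _ => hr _ _)
  have h3 := Finset.sum_congr (rfl : (Finset.univ : Finset ι) = Finset.univ) fun i _ =>
    h.curvMap_bismut_cyclic hz X Y (e i) (J z (e i))
  simp only [Finset.sum_add_distrib, h1, h2, ← Finset.mul_sum] at h3
  have h4 := h.covTensor_leeForm_eq_sum hz e he X (J z Y)
  simp only [h.J_sq z hz, map_neg, neg_apply, Finset.sum_neg_distrib] at h4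
  rw [h4, h.ricciForm_bismut_eq_sum hz e he, h.lambdaOmega_eq_sum hz e he]
  linarith

/-- The type `(1,2) + (2,1)` of the torsion gives a quadratic trace identity. -/
theorem sum_torsion_J (h : IsHermitianOn G J U) {z : E} (hz : z ∈ U)
    (e : Module.Basis ι ℝ E) (he : ∀ i j, G z (e i) (e j) = if i = j then 1 else 0) :
    normSq₃ (G z) (torsionForm G J z) = 3 * ∑ i, ∑ j,
      G z (torsionMap G J z (e i) (e j)) (torsionMap G J z (J z (e i)) (J z (e j))) := by
  have h1 : ∀ a b c d, G z (torsionMap G J z a b) (torsionMap G J z c d)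
      = ∑ k, dcMap G J z a b (e k) * dcMap G J z c d (e k) := by
    intro a b c d
    rw [inner_eq_sum e he]
    simp only [h.inner_torsionMap hz]
  let f : ι → ι → ι → ℝ := fun i j k =>
    dcMap G J z (e i) (e j) (e k) * dcMap G J z (J z (e i)) (J z (e j)) (e k)
  -- One factor is expanded by the type condition. The three products are `f` with permuted indices,
  -- hence have equal total sums; this is the factor 3.
  have h2 : ∀ i j k, dcMap G J z (e i) (e j) (e k) * dcMap G J z (e i) (e j) (e k)
      = f i j k + f i k j + f j k i := by
    intro i j k
    have a1 := h.dcMap_skew₂ hz (e i) (e j) (e k)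
    have a2 := h.dcMap_skew₂ hz (J z (e i)) (e j) (J z (e k))
    have a3 := h.dcMap_skew₁ hz (e i) (e k) (e j)
    have a4 := h.dcMap_skew₂ hz (e k) (e i) (e j)
    have a5 := h.dcMap_skew₁ hz (e k) (e j) (e i)
    have a6 := h.dcMap_skew₁ hz (e i) (J z (e j)) (J z (e k))
    have a7 := h.dcMap_skew₂ hz (J z (e j)) (e i) (J z (e k))
    have a8 : dcMap G J z (e i) (e j) (e k) = dcMap G J z (e j) (e k) (e i) := by linarith
    have a9 : dcMap G J z (e i) (J z (e j)) (J z (e k))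
      = dcMap G J z (J z (e j)) (J z (e k)) (e i) := by linarith
    have b : f i k j = dcMap G J z (e i) (e j) (e k) * dcMap G J z (J z (e i)) (e j) (J z (e k)) := by
      simp only [f]; rw [a1, a2]; ring
    have c : f j k i = dcMap G J z (e i) (e j) (e k) * dcMap G J z (e i) (J z (e j)) (J z (e k)) := by
      simp only [f]; rw [a8, a9]
    rw [b, c]
    conv_lhs => arg 2; rw [h.dcMap_type hz]
    simp only [f]
    ring
  rw [h.normSq₃_torsionForm_eq_sum hz e he]
  simp only [h2, h1, Finset.sum_add_distrib]
  have c1 : ∑ i, ∑ j, ∑ k, f i k j = ∑ i, ∑ j, ∑ k, f i j k :=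
    Finset.sum_congr rfl fun i _ => Finset.sum_comm
  have c2 : ∑ i, ∑ j, ∑ k, f j k i = ∑ i, ∑ j, ∑ k, f i j k := by
    rw [Finset.sum_comm]
    exact Finset.sum_congr rfl fun i _ => Finset.sum_comm
  rw [c1, c2]
  simp only [f]
  ring

/-- In terms of `S`, `W` and `t`: `S = 2 d†θ`, `|t|² = 4|θ|²` and `|T|² = 3W`. The trace of `∇θ`
gives `-½S` and a quarter of the trace of `λ^Ω` gives `-S - ½|t|² + W`. -/
theorem sum_ricciForm_bismut_eq (h : IsHermitianOn G J U) {z : E} (hz : z ∈ U)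
    (e : Module.Basis ι ℝ E) (he : ∀ i j, G z (e i) (e j) = if i = j then 1 else 0) :
    ∑ j, ricciForm G J (bismut G J) z (J z (e j)) (e j) =
      ∑ j, ricci G (bismut G J) z (e j) (e j) - 3 * codiff G (leeForm G J) z ![]
        - 2 * normSq₁ (G z) (leeForm G J z) + 1 / 3 * normSq₃ (G z) (torsionForm G J z) := by
  have hP := h.nablaJ_spec hz
  set N := covMap (bismutMap G J) (dcMap G J) z with hN
  set K := torsionMap G J z with hK
  set S : ℝ := ∑ j, ∑ i, N (e j) (J z (e j)) (e i) (J z (e i)) with hS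
  set W : ℝ := ∑ j, ∑ i, G z (K (e j) (e i)) (K (J z (e j)) (J z (e i))) with hW
  set t := torsionTrace G J z e with ht
  have hs := h.cov_skew₁ hz (bismutMap G J)
  have hs' := h.cov_skew₂ hz (bismutMap G J)
  rw [← hN] at hs hs'
  have hric : ∑ j, ricci G (bismut G J) z (J z (e j)) (J z (e j))
      = ∑ j, ricci G (bismut G J) z (e j) (e j) := by
    simp only [h.ricci_bismut_eq_sum hz e he]
    rw [Finset.sum_comm]
    conv_rhs => rw [Finset.sum_comm]
    exact Finset.sum_congr rfl fun i _ => sum_isometry hP.pos hP.compat hP.J_sq e he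
      (post ((G z).flip (e i)) (curvMap (bismutMap G J) z (e i)))
  have hT₁ : ∑ j, ∑ i, N (J z (e j)) (e j) (e i) (J z (e i)) = - S := by
    rw [hS, Finset.sum_comm]
    conv_rhs => rw [Finset.sum_comm]
    rw [← Finset.sum_neg_distrib]
    exact Finset.sum_congr rfl fun i _ => sum_isometry_left hP.pos hP.compat hP.J_sq e he
      (post (evalPair (e i) (J z (e i))) N)
  have hT₃ : ∑ j, ∑ i, N (e i) (J z (e j)) (e j) (J z (e i)) = - S := by
    rw [hS, Finset.sum_comm, ← Finset.sum_neg_distrib]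
    refine Finset.sum_congr rfl fun i _ => ?_
    rw [← Finset.sum_neg_distrib]
    refine Finset.sum_congr rfl fun j _ => ?_
    rw [hs', hs, hs', neg_neg]
  have hT₄ : ∑ j, ∑ i, N (J z (e i)) (J z (e j)) (e j) (e i) = S := by
    rw [← neg_eq_iff_eq_neg.2 hT₁, Finset.sum_comm, ← Finset.sum_neg_distrib]
    refine Finset.sum_congr rfl fun i _ => ?_
    rw [← Finset.sum_neg_distrib]
    refine Finset.sum_congr rfl fun j _ => ?_
    rw [hs', hs, hs', neg_neg]
  have hcov : ∑ j, covTensor (bismut G J) (leeForm G J) z (J z (e j)) ![J z (e j)]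
      = -(1 / 2) * S := by
    simp only [h.covTensor_leeForm_eq_sum hz e he, h.J_sq z hz, map_neg, neg_apply,
      Finset.sum_neg_distrib, ← Finset.mul_sum, ← hN, hT₁, neg_neg]
  have hQ₁ : ∑ j, ∑ i, G z (K (J z (e j)) (e j)) (K (e i) (J z (e i))) = - G z t t := by
    have : G z t t = ∑ j, ∑ i, G z (K (e j) (J z (e j))) (K (e i) (J z (e i))) := by
      rw [ht, torsionTrace]
      simp only [map_sum, sum_apply]
      rw [Finset.sum_comm]
    rw [this, ← Finset.sum_neg_distrib]
    refine Finset.sum_congr rfl fun j _ => ?_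
    rw [← Finset.sum_neg_distrib]
    refine Finset.sum_congr rfl fun i _ => ?_
    rw [hK, h.torsionMap_skew hz (J z (e j))]
    simp
  have hQ₃ : ∑ j, ∑ i, G z (K (e i) (J z (e j))) (K (e j) (J z (e i))) = W := by
    rw [hW, Finset.sum_comm]
    conv_rhs => rw [Finset.sum_comm]
    refine Finset.sum_congr rfl fun i _ => ?_
    have := sum_isometry_left hP.pos hP.compat hP.J_sq e he
      ((G z).bilinearComp (K.flip (e i)) (K.flip (J z (e i))))
    simp only [ContinuousLinearMap.bilinearComp_apply, ContinuousLinearMap.flip_apply] at this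
    rw [← neg_eq_iff_eq_neg.2 this, ← Finset.sum_neg_distrib]
    refine Finset.sum_congr rfl fun j _ => ?_
    rw [hK, h.torsionMap_skew hz (e i)]
    simp
  -- Each of the four signed derivative terms of `dT(Je_j, e_j, e_i, Je_i)` contributes `-S`; the
  -- three products contribute `-|t|²`, `W` and `W`.
  have hlam : ∑ j, lambdaOmega G J z (J z (e j)) (e j) = -4 * S + 2 * (- G z t t + W + W) := by
    simp only [h.lambdaOmega_eq_sum hz e he, h.extD_torsionForm_bismut hz, ← hN, ← hK,
      Finset.sum_add_distrib, Finset.sum_sub_distrib, ← Finset.mul_sum]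
    rw [hT₁, hT₃, hT₄, hQ₁, hQ₃, ← hW, ← hS]
    ring
  simp only [h.ricciForm_bismut_eq hz e he, Finset.sum_add_distrib, ← Finset.mul_sum]
  rw [hric, hcov, hlam, h.codiff_leeForm_eq_sum hz e he, h.normSq₁_leeForm_eq hz e he,
    h.sum_torsion_J hz e he]
  rw [← hN, ← hS, ← ht, ← hK, ← hW]
  ring

end IsHermitianOn
end Identities

/-! ### Hermitian algebra under a linear change of coordinates -/

section Conjugation

variable {E : Type*} [NormedAddCommGroup E] [NormedSpace ℝ E]
  {C D j : E →L[ℝ] E} {b : E →L[ℝ] E →L[ℝ] ℝ}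

/-- `C` and `D` play the derivatives of a chart and of its inverse; the left inverse `C` makes `D`
injective. -/
theorem bilinearComp_pos (hCD : C ∘L D = ContinuousLinearMap.id ℝ E)
    (pos : ∀ v, v ≠ 0 → 0 < b v v) (v : E) (hv : v ≠ 0) : 0 < b.bilinearComp D D v v := by
  refine pos _ fun h0 => hv ?_
  have h : C (D v) = v := congrArg (fun L : E →L[ℝ] E => L v) hCD
  rw [← h]
  exact (congrArg C h0).trans (map_zero C)

theorem conj_sq (hCD : C ∘L D = ContinuousLinearMap.id ℝ E)
    (hDC : D ∘L C = ContinuousLinearMap.id ℝ E) (hj : ∀ v, j (j v) = -v) (v : E) :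
    (C ∘L j ∘L D) ((C ∘L j ∘L D) v) = -v := by
  have h : C (D v) = v := congrArg (fun L : E →L[ℝ] E => L v) hCD
  have h' : D (C (j (D v))) = j (D v) := congrArg (fun L : E →L[ℝ] E => L (j (D v))) hDC
  simp [h', hj, h]

theorem conj_compat (hDC : D ∘L C = ContinuousLinearMap.id ℝ E)
    (hj : ∀ v w, b (j v) (j w) = b v w) (v w : E) :
    b.bilinearComp D D ((C ∘L j ∘L D) v) ((C ∘L j ∘L D) w) = b.bilinearComp D D v w := by
  have h : ∀ u, D (C u) = u := fun u => congrArg (fun L : E →L[ℝ] E => L u) hDC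
  simp [h, hj]

end Conjugation

/-! ### The Hermitian structure in a preferred chart -/

section Charts

variable {E : Type*} [NormedAddCommGroup E] [NormedSpace ℝ E]
  {M : Type*} [TopologicalSpace M] [ChartedSpace E M]

theorem chart_symm_mem (x : M) {y : E} (hy : y ∈ (extChartAt 𝓘(ℝ, E) x).target) :
    (extChartAt 𝓘(ℝ, E) x).symm y ∈ (chartAt E x).source := by
  rw [← extChartAt_source 𝓘(ℝ, E)]
  exact (extChartAt 𝓘(ℝ, E) x).map_target hy

variable [IsManifold 𝓘(ℝ, E) ∞ M]

/-- The coordinate vector field of the preferred chart at `x` with constant component `u`. -/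
def coordField (x : M) (u : E) (m : M) : TangentSpace 𝓘(ℝ, E) m :=
  (trivializationAt E (TangentSpace 𝓘(ℝ, E)) x).symmL ℝ m u

theorem contMDiffOn_coordField (x : M) (u : E) :
    ContMDiffOn 𝓘(ℝ, E) (𝓘(ℝ, E).prod 𝓘(ℝ, E)) ∞
      (fun m : M => TotalSpace.mk' E (E := TangentSpace 𝓘(ℝ, E)) m (coordField x u m))
      (chartAt E x).source := by
  rw [(trivializationAt E (TangentSpace 𝓘(ℝ, E)) x).contMDiffOn_iff]
  · refine ⟨contMDiffOn_id, contMDiffOn_const (c := u) |>.congr fun m hm => ?_⟩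
    have hm' : m ∈ (trivializationAt E (TangentSpace 𝓘(ℝ, E)) x).baseSet := hm
    rw [coordField, Trivialization.symmL_apply _ hm']
    exact congrArg Prod.snd
      ((trivializationAt E (TangentSpace 𝓘(ℝ, E)) x).apply_mk_symm hm' u)
  · intro m hm
    simpa [Trivialization.mem_source] using hm

/-- The chart derivative is the tangent bundle trivialization, so smoothness of `g` and `J` as
bundle sections becomes smoothness of their coordinate expressions. -/
theorem mfderiv_symm_eq (x : M) {y : E} (hy : y ∈ (extChartAt 𝓘(ℝ, E) x).target) (u : E) :
    mfderiv 𝓘(ℝ, E) 𝓘(ℝ, E) (extChartAt 𝓘(ℝ, E) x).symm y u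
      = coordField x u ((extChartAt 𝓘(ℝ, E) x).symm y) := by
  have : IsManifold 𝓘(ℝ, E) 1 M := IsManifold.of_le (n := ∞) (by norm_cast)
  have h := TangentBundle.symmL_trivializationAt (I := 𝓘(ℝ, E)) (chart_symm_mem x hy)
  rw [coordField, h, (extChartAt 𝓘(ℝ, E) x).right_inv hy]
  simp only [modelWithCornersSelf_coe, Set.range_id, mfderivWithin_univ]
  rfl

theorem mfderiv_chart_comp_symm (x : M) {y : E} (hy : y ∈ (extChartAt 𝓘(ℝ, E) x).target) :
    (mfderiv 𝓘(ℝ, E) 𝓘(ℝ, E) (extChartAt 𝓘(ℝ, E) x) ((extChartAt 𝓘(ℝ, E) x).symm y)) ∘L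
      (mfderiv 𝓘(ℝ, E) 𝓘(ℝ, E) (extChartAt 𝓘(ℝ, E) x).symm y)
      = ContinuousLinearMap.id ℝ E := by
  have : IsManifold 𝓘(ℝ, E) 1 M := IsManifold.of_le (n := ∞) (by norm_cast)
  have h := mfderiv_extChartAt_comp_mfderivWithin_extChartAt_symm (I := 𝓘(ℝ, E)) hy
  simp only [modelWithCornersSelf_coe, Set.range_id, mfderivWithin_univ] at h
  exact h

theorem mfderiv_symm_comp_chart (x : M) {y : E} (hy : y ∈ (extChartAt 𝓘(ℝ, E) x).target) :
    (mfderiv 𝓘(ℝ, E) 𝓘(ℝ, E) (extChartAt 𝓘(ℝ, E) x).symm y) ∘L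
      (mfderiv 𝓘(ℝ, E) 𝓘(ℝ, E) (extChartAt 𝓘(ℝ, E) x) ((extChartAt 𝓘(ℝ, E) x).symm y))
      = ContinuousLinearMap.id ℝ (TangentSpace 𝓘(ℝ, E) ((extChartAt 𝓘(ℝ, E) x).symm y)) := by
  have : IsManifold 𝓘(ℝ, E) 1 M := IsManifold.of_le (n := ∞) (by norm_cast)
  have h := mfderivWithin_extChartAt_symm_comp_mfderiv_extChartAt (I := 𝓘(ℝ, E)) hy
  simp only [modelWithCornersSelf_coe, Set.range_id, mfderivWithin_univ] at h
  exact h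

namespace HermitianStructure

variable (S : HermitianStructure E M)

theorem gLoc_apply (x : M) {y : E} (hy : y ∈ (extChartAt 𝓘(ℝ, E) x).target) (u v : E) :
    S.gLoc x y u v = S.g.inner ((extChartAt 𝓘(ℝ, E) x).symm y)
      (coordField x u ((extChartAt 𝓘(ℝ, E) x).symm y))
      (coordField x v ((extChartAt 𝓘(ℝ, E) x).symm y)) := by
  rw [← mfderiv_symm_eq x hy, ← mfderiv_symm_eq x hy]
  rfl

theorem JLoc_apply (x : M) {y : E} (hy : y ∈ (extChartAt 𝓘(ℝ, E) x).target) (u : E) :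
    S.JLoc x y u = (trivializationAt E (TangentSpace 𝓘(ℝ, E)) x
      (TotalSpace.mk' E ((extChartAt 𝓘(ℝ, E) x).symm y) (S.J ((extChartAt 𝓘(ℝ, E) x).symm y)
        (coordField x u ((extChartAt 𝓘(ℝ, E) x).symm y))))).2 := by
  have : IsManifold 𝓘(ℝ, E) 1 M := IsManifold.of_le (n := ∞) (by norm_cast)
  have hm : (extChartAt 𝓘(ℝ, E) x).symm y ∈
    (trivializationAt E (TangentSpace 𝓘(ℝ, E)) x).baseSet := chart_symm_mem x hy
  have h := TangentBundle.continuousLinearMapAt_trivializationAt (I := 𝓘(ℝ, E))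
    (chart_symm_mem x hy)
  have h1 := (trivializationAt E (TangentSpace 𝓘(ℝ, E)) x).coe_linearMapAt_of_mem (R := ℝ) hm
  have h2 := congrFun h1 (S.J ((extChartAt 𝓘(ℝ, E) x).symm y)
        (coordField x u ((extChartAt 𝓘(ℝ, E) x).symm y)))
  refine Eq.trans ?_ h2
  rw [← mfderiv_symm_eq x hy]
  exact (congrArg (fun L : TangentSpace 𝓘(ℝ, E) ((extChartAt 𝓘(ℝ, E) x).symm y) →L[ℝ] E =>
    L (S.J ((extChartAt 𝓘(ℝ, E) x).symm y)
      (mfderiv 𝓘(ℝ, E) 𝓘(ℝ, E) (extChartAt 𝓘(ℝ, E) x).symm y u))) h).symm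

theorem gLoc_symm (x : M) {y : E} (hy : y ∈ (extChartAt 𝓘(ℝ, E) x).target) (u v : E) :
    S.gLoc x y u v = S.gLoc x y v u := by
  rw [S.gLoc_apply x hy, S.gLoc_apply x hy, S.g.symm]

theorem gLoc_pos (x : M) {y : E} (hy : y ∈ (extChartAt 𝓘(ℝ, E) x).target) (v : E) (hv : v ≠ 0) :
    0 < S.gLoc x y v v :=
  bilinearComp_pos (E := E) (b := S.g.inner ((extChartAt 𝓘(ℝ, E) x).symm y))
    (mfderiv_chart_comp_symm x hy) (S.g.pos ((extChartAt 𝓘(ℝ, E) x).symm y)) v hv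

theorem JLoc_sq (x : M) {y : E} (hy : y ∈ (extChartAt 𝓘(ℝ, E) x).target) (v : E) :
    S.JLoc x y (S.JLoc x y v) = -v :=
  conj_sq (E := E) (j := S.J ((extChartAt 𝓘(ℝ, E) x).symm y)) (mfderiv_chart_comp_symm x hy)
    (mfderiv_symm_comp_chart x hy) (S.J_sq ((extChartAt 𝓘(ℝ, E) x).symm y)) v

theorem gLoc_compat (x : M) {y : E} (hy : y ∈ (extChartAt 𝓘(ℝ, E) x).target) (v w : E) :
    S.gLoc x y (S.JLoc x y v) (S.JLoc x y w) = S.gLoc x y v w :=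
  conj_compat (E := E) (j := S.J ((extChartAt 𝓘(ℝ, E) x).symm y))
    (b := S.g.inner ((extChartAt 𝓘(ℝ, E) x).symm y))
    (mfderiv_symm_comp_chart x hy) (S.compatible ((extChartAt 𝓘(ℝ, E) x).symm y)) v w

variable [FiniteDimensional ℝ E]

theorem contDiffOn_gLoc (x : M) :
    ContDiffOn ℝ ∞ (S.gLoc x) (extChartAt 𝓘(ℝ, E) x).target := by
  refine contDiffOn_clm_apply₂ fun u v => ?_
  rw [← contMDiffOn_iff_contDiffOn]
  have h1 : ContMDiffOn 𝓘(ℝ, E) 𝓘(ℝ) ∞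
      (fun m => S.g.inner m (coordField x u m) (coordField x v m)) (chartAt E x).source := by
    have : ContMDiffOn 𝓘(ℝ, E) (𝓘(ℝ, E).prod 𝓘(ℝ)) ∞
        (fun m => TotalSpace.mk' ℝ (E := Bundle.Trivial M ℝ) m
          (S.g.inner m (coordField x u m) (coordField x v m))) (chartAt E x).source :=
      ContMDiffOn.clm_bundle_apply₂ (F₁ := E) (F₂ := E) S.g.contMDiff.contMDiffOn
        (contMDiffOn_coordField x u) (contMDiffOn_coordField x v)
    intro m hm
    have := this m hm
    rw [contMDiffWithinAt_totalSpace] at this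
    exact this.2
  refine (h1.comp (contMDiffOn_extChartAt_symm x) fun y hy => chart_symm_mem x hy).congr
    fun y hy => S.gLoc_apply x hy u v

theorem contDiffOn_JLoc (x : M) :
    ContDiffOn ℝ ∞ (S.JLoc x) (extChartAt 𝓘(ℝ, E) x).target := by
  refine contDiffOn_clm_apply.2 fun u => ?_
  rw [← contMDiffOn_iff_contDiffOn]
  have h1 : ContMDiffOn 𝓘(ℝ, E) (𝓘(ℝ, E).prod 𝓘(ℝ, E)) ∞
      (fun m => TotalSpace.mk' E (E := TangentSpace 𝓘(ℝ, E)) m (S.J m (coordField x u m)))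
      (chartAt E x).source :=
    ContMDiffOn.clm_bundle_apply (F₁ := E) (F₂ := E) S.contMDiff_J.contMDiffOn
      (contMDiffOn_coordField x u)
  rw [(trivializationAt E (TangentSpace 𝓘(ℝ, E)) x).contMDiffOn_iff
    (fun m hm => by simpa [Trivialization.mem_source] using hm)] at h1
  refine (h1.2.comp (contMDiffOn_extChartAt_symm x) fun y hy => chart_symm_mem x hy).congr
    fun y hy => S.JLoc_apply x hy u

theorem isHermitianOn (x : M) :
    IsHermitianOn (S.gLoc x) (S.JLoc x) (extChartAt 𝓘(ℝ, E) x).target where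
  isOpen := isOpen_extChartAt_target x
  smooth_G := S.contDiffOn_gLoc x
  smooth_J := S.contDiffOn_JLoc x
  symm := fun _ hy => S.gLoc_symm x hy
  pos := fun _ hy => S.gLoc_pos x hy
  J_sq := fun _ hy => S.JLoc_sq x hy
  compat := fun _ hy => S.gLoc_compat x hy
  nij := S.integrable x

end HermitianStructure
end Charts
end KT
end

/-! ### Passage from the chart to the manifold -/

theorem mainTheorem11 {E : Type*} [NormedAddCommGroup E] [NormedSpace ℝ E]
    [FiniteDimensional ℝ E] {M : Type*} [TopologicalSpace M] [ChartedSpace E M]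
    [IsManifold 𝓘(ℝ, E) ∞ M] (S : KT.HermitianStructure E M) (x : M)
    {ι : Type*} [Fintype ι] [DecidableEq ι]
    (e : Module.Basis ι ℝ (TangentSpace 𝓘(ℝ, E) x))
    (he : ∀ i j, S.g.inner x (e i) (e j) = if i = j then 1 else 0) :
    (∀ X Y : TangentSpace 𝓘(ℝ, E) x,
      S.ricciLC x X Y = S.ricciBismut x X Y + 1 / 2 * S.codiffT x X Y
        + 1 / 4 * ∑ i, S.g.inner x (S.T x X (e i)) (S.T x Y (e i))) ∧
    (∀ X Y : TangentSpace 𝓘(ℝ, E) x,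
      S.rho x X Y = S.ricciBismut x X (S.J x Y) + S.covTheta x X (S.J x Y)
        + 1 / 4 * S.lam x X Y) ∧
    ∑ j, S.rho x (S.J x (e j)) (e j) =
      ∑ j, S.ricciBismut x (e j) (e j) - 3 * S.codiffTheta x - 2 * S.normSqTheta x
        + 1 / 3 * S.normSqT x := by
  have h := S.isHermitianOn x
  have hz : KT.HermitianStructure.pt x ∈ (extChartAt 𝓘(ℝ, E) x).target :=
    mem_extChartAt_target x
  -- At the base point the chart derivative is the identity, so the given basis is orthonormal for
  -- the coordinate metric as well and the chart identities apply verbatim.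
  have hg := S.gLoc_pt x
  have hJ := S.JLoc_pt x
  have he' : ∀ i j, S.gLoc x (KT.HermitianStructure.pt x) (e i) (e j) = if i = j then 1 else 0 :=
    fun i j => (hg _ _).trans (he i j)
  refine ⟨fun X Y => ?_, fun X Y => ?_, ?_⟩
  · simp only [← hg]
    exact h.ricci_leviCivita_eq hz e he' X Y
  · rw [← hJ]
    exact h.ricciForm_bismut_eq hz e he' X Y
  · simp only [← hJ]
    exact h.sum_ricciForm_bismut_eq hz e he'
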